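/- Let $n\ge 1$ and $0<\lambda<\frac{2\pi}{n}$. Write $\mathbb D=\{|z|<1\}$, $\mathbb T=\{|z|=1\}$, and let $\pi_n(\Omega)$ be the set of complex polynomials of degree exactly $n$ all of whose zeros lie in $\Omega$. For a polynomial $F$ put $F_{\pm}(z)=F(e^{\pm i\lambda/2}z)$, and for $F$ of degree at most $n$ put $F^{*n}(z)=z^n\overline{F(1/\overline z)}$. For $F\in\pi_n(\mathbb T)$ let $c_F$ be the unique number in $\{e^{it}:0\le t<\pi\}$ with $(c_FF)^{*n}=c_FF$. Let $\overline{\mathcal T}_n(\lambda)$ (respectively $\mathcal T_n(\lambda)$) be the set of $F\in\pi_n(\mathbb T)$ for which any two zeros (listed with multiplicity) are separated by an angle $\ge\lambda$ (respectively $>\lambda$). Let $\overline{\mathcal D}_n(\lambda)$ be the set of polynomials $F$ of degree $n$ with $$\operatorname{Im}\Bigl(e^{-in\lambda/2}\,\frac{F_+(z)}{F_-(z)}\Bigr)>0\qquad\text{for all } |z|>1,$$ and let $\mathcal D_n(\lambda)$ be the union of $\mathcal T_n(\lambda)$ with the set of polynomials $F$ of degree $n$ for which this inequality holds for all $|z|\ge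 1$. Let $P,Q\in\pi_n(\mathbb T)$ with $c_P\neq c_Q$, and set $F=P-Q$, $$S=P_+Q_--P_-Q_+,\qquad T=F_+\,(F^{*n})_--F_-\,(F^{*n})_+ .$$ Zeros and critical points are counted with multiplicity; the statement that all zeros of a polynomial on $\mathbb T$ have even order includes that the polynomial is not identically zero, and the statement that a polynomial has exactly $n-1$ critical points in a set includes that its derivative is not identically zero. Then: 1. If $F\in\pi_n(\mathbb D)$ and all zeros of $S$ on $\mathbb T$, or all zeros of $T$ on $\mathbb T$, have even order, then $F\in\overline{\mathcal D}_n(\lambda)\setminus\overline{\mathcal T}_n(\lambda)$. 2. If $F\in\overline{\mathcal D}_n(\lambda)\setminus\overline{\mathcal T}_n(\lambda)$, then all zeros of $S$ and all zeros of $T$ on $\mathbb T$ have even order. 3. If $F\in\pi_n(\mathbb D)$ and $S$ or $T$ has exactly $n-1$ critical points in $\overline{\mathbb D}$, then $F\in\mathcal D_n(\lambda)\setminus\mathcal T_n(\lambda)$. 4. If $F\in\mathcal D_n(\lambda)\setminus\mathcal T_n(\lambda)$, then both $S$ and $T$ have exactly $n-1$ critical points in $\mathbb D$. -/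

import Mathlib

open Polynomial

noncomputable section

/-- `π_n(Ω)`: the complex polynomials of degree exactly `n` all of whose zeros lie in `Ω`. -/
def polysWithZerosIn (n : ℕ) (Ω : Set ℂ) : Set ℂ[X] :=
  {F | F.degree = n ∧ ∀ z : ℂ, F.IsRoot z → z ∈ Ω}

/-- The open unit disk `𝔻`. -/
def openDisk : Set ℂ := {z | ‖z‖ < 1}

/-- The closed unit disk. -/
def closedDisk : Set ℂ := {z | ‖z‖ ≤ 1}

/-- The unit circle `𝕋`. -/
def unitCircle : Set ℂ := {z | ‖z‖ = 1}

/-- `F(e^{iθ} z)` as a polynomial in `z`. -/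
def rotate (θ : ℝ) (F : ℂ[X]) : ℂ[X] :=
  F.comp (C (Complex.exp (Complex.I * θ)) * X)

/-- `F_+(z) = F(e^{iλ/2} z)`. -/
def plusRot (lam : ℝ) (F : ℂ[X]) : ℂ[X] := rotate (lam / 2) F

/-- `F_-(z) = F(e^{-iλ/2} z)`. -/
def minusRot (lam : ℝ) (F : ℂ[X]) : ℂ[X] := rotate (-(lam / 2)) F

/-- The `n`-inverse `F^{*n}(z) = z^n conj (F (1 / conj z))` of a polynomial of degree at most `n`:
the coefficient of `z^k` is the complex conjugate of the coefficient of `z^(n-k)` of `F`. -/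
def nInverse (n : ℕ) (F : ℂ[X]) : ℂ[X] := (F.map (starRingEnd ℂ)).reflect n

/-- `c = e^{it}` with `t ∈ [0, π)` and `(cF)^{*n} = cF`, that is, `c` is the number `c_F`. -/
def IsSelfInversiveConst (n : ℕ) (F : ℂ[X]) (c : ℂ) : Prop :=
  (∃ t : ℝ, 0 ≤ t ∧ t < Real.pi ∧ c = Complex.exp (Complex.I * t)) ∧
    nInverse n (C c * F) = C c * F

/-- A polynomial with all zeros on the unit circle is self-inversive up to a unimodular factor. -/
theorem exists_nInverse_eq (n : ℕ) :
    ∀ F : ℂ[X], F ∈ polysWithZerosIn n unitCircle → ∃ u : ℂ, ‖u‖ = 1 ∧ nInverse n F = C u * F := by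
  induction n with
  | zero =>
    intro F hF
    obtain ⟨a, ha⟩ : ∃ a, F = C a := ⟨_, Polynomial.eq_C_of_degree_le_zero (by simp [hF.1])⟩
    have ha0 : a ≠ 0 := by
      rintro rfl
      have := hF.1
      simp [ha] at this
    refine ⟨starRingEnd ℂ a / a, ?_, ?_⟩
    · simp [ha0]
    · subst ha
      rw [nInverse, map_C, reflect_C, ← C_mul, div_mul_cancel₀ _ ha0]
      simp
  | succ n ih =>
    intro F hF
    have hd : F.degree = (n + 1 : ℕ) := hF.1
    obtain ⟨w, hw⟩ := Complex.exists_root (f := F) (by rw [hd]; exact_mod_cast Nat.succ_pos n)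
    obtain ⟨G, hG⟩ := dvd_iff_isRoot.2 hw
    have hF0 : F ≠ 0 := by rintro rfl; rw [degree_zero] at hd; exact WithBot.bot_ne_coe hd
    have hG0 : G ≠ 0 := by rintro rfl; simp [hF0] at hG
    have hn : F.natDegree = n + 1 := natDegree_eq_of_degree_eq_some hd
    have hGn : G.natDegree = n := by
      rw [hG, natDegree_mul (X_sub_C_ne_zero w) hG0, natDegree_X_sub_C] at hn
      omega
    obtain ⟨u, hu, hGu⟩ := ih G ⟨by rw [degree_eq_natDegree hG0, hGn], fun z hz => hF.2 z (by
      rw [hG]; simp [IsRoot.def.1 hz])⟩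
    have hw1 : ‖w‖ = 1 := hF.2 w hw
    have hww : starRingEnd ℂ w * w = 1 := by
      rw [mul_comm, Complex.mul_conj, Complex.normSq_eq_norm_sq, hw1]; simp
    refine ⟨-(starRingEnd ℂ w) * u, by simp [hw1, hu], ?_⟩
    have h1 : (X - C (starRingEnd ℂ w) : ℂ[X]).reflect 1 = C (-(starRingEnd ℂ w)) * (X - C w) := by
      rw [reflect_sub, reflect_C, reflect_one_X, mul_sub, ← C_mul, neg_mul, hww]
      simp
      ring
    have h2 : nInverse (n + 1) F = (X - C (starRingEnd ℂ w) : ℂ[X]).reflect 1 * nInverse n G := by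
      rw [nInverse, nInverse, hG, Polynomial.map_mul, add_comm n 1,
        reflect_mul _ _ (by simp) (by simp [hGn])]
      simp
    rw [h2, h1, hGu, hG, C_mul]
    ring

/-- The number `c_F` exists and is unique for `F ∈ π_n(𝕋)`. -/
theorem existsUnique_selfInversiveConst (n : ℕ) (F : ℂ[X])
    (hF : F ∈ polysWithZerosIn n unitCircle) : ∃! c : ℂ, IsSelfInversiveConst n F c := by
  obtain ⟨u, hu, hFu⟩ := exists_nInverse_eq n F hF
  have hF0 : F ≠ 0 := by
    rintro rfl
    have := hF.1
    simp at this
  have key : ∀ c : ℂ, ‖c‖ = 1 → (nInverse n (C c * F) = C c * F ↔ c ^ 2 = u) := by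
    intro c hc
    have hcc : starRingEnd ℂ c * c = 1 := by
      rw [mul_comm, Complex.mul_conj, Complex.normSq_eq_norm_sq, hc]; simp
    have : nInverse n (C c * F) = C (starRingEnd ℂ c * u) * F := by
      rw [C_mul, mul_assoc, ← hFu, nInverse, nInverse, Polynomial.map_mul, map_C, reflect_C_mul]
    rw [this, mul_left_inj' hF0, C_inj]
    constructor
    · intro h
      linear_combination (-c) * h + u * hcc
    · intro h
      linear_combination (-starRingEnd ℂ c) * h + c * hcc
  have hnorm : ∀ t : ℝ, ‖Complex.exp (Complex.I * t)‖ = 1 := fun t => by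
    rw [mul_comm, Complex.norm_exp_ofReal_mul_I]
  have hpi : Complex.exp (Complex.I * Real.pi) = -1 := by
    rw [mul_comm, Complex.exp_pi_mul_I]
  obtain ⟨s, hs0, hs1, hs⟩ : ∃ s : ℝ, 0 ≤ s ∧ s < Real.pi ∧
      Complex.exp (Complex.I * s) ^ 2 = u := by
    have h : Complex.exp (Complex.I * u.arg) = u := by
      have := Complex.norm_mul_exp_arg_mul_I u
      rw [hu] at this
      rw [mul_comm]; simpa using this
    have h' : Complex.exp (Complex.I * ((u.arg / 2 : ℝ) : ℂ)) ^ 2 = u := by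
      rw [← Complex.exp_nat_mul, ← h]
      congr 1
      rw [h]; push_cast; ring
    have hpos := Real.pi_pos
    have ha := Complex.neg_pi_lt_arg u
    have hb := Complex.arg_le_pi u
    by_cases hneg : 0 ≤ u.arg
    · exact ⟨u.arg / 2, by linarith, by linarith, h'⟩
    · refine ⟨u.arg / 2 + Real.pi, by linarith, by linarith, ?_⟩
      rw [Complex.ofReal_add, mul_add, Complex.exp_add, hpi, mul_pow, h']
      simp
  refine ⟨_, ⟨⟨s, hs0, hs1, rfl⟩, (key _ (hnorm s)).2 hs⟩, ?_⟩
  rintro c ⟨⟨t, ht0, ht1, rfl⟩, hc⟩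
  have ht := (key _ (hnorm t)).1 hc
  rw [← hs, sq_eq_sq_iff_eq_or_eq_neg] at ht
  rcases ht with ht | ht
  · exact ht
  · have him := congrArg Complex.im ht
    have hre := congrArg Complex.re ht
    rw [mul_comm, mul_comm Complex.I, Complex.neg_im, Complex.exp_ofReal_mul_I_im,
      Complex.exp_ofReal_mul_I_im] at him
    rw [mul_comm, mul_comm Complex.I, Complex.neg_re, Complex.exp_ofReal_mul_I_re,
      Complex.exp_ofReal_mul_I_re] at hre
    have h1 := Real.sin_nonneg_of_nonneg_of_le_pi ht0 ht1.le
    have h2 := Real.sin_nonneg_of_nonneg_of_le_pi hs0 hs1.le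
    have e1 : Real.sin t = 0 := by linarith
    have e2 : Real.sin s = 0 := by linarith
    have f1 := (Real.sin_eq_zero_iff_of_lt_of_lt (by linarith) ht1).1 e1
    have f2 := (Real.sin_eq_zero_iff_of_lt_of_lt (by linarith) hs1).1 e2
    rw [f1, f2]

/-- Polynomials of degree `n` with zeros only on the unit circle, each pair of zeros (taken from
the multiset of zeros, so a multiple zero gives a pair at angle `0`) being separated by an angle
of at least `lam`. -/
def closedT (n : ℕ) (lam : ℝ) : Set ℂ[X] :=
  {F | F ∈ polysWithZerosIn n unitCircle ∧
    ∀ z w : ℂ, ({z, w} : Multiset ℂ) ≤ F.roots → lam ≤ |Complex.arg (z / w)|}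

/-- Polynomials of degree `n` with zeros only on the unit circle, each pair of zeros (taken from
the multiset of zeros) being separated by an angle greater than `lam`. -/
def openT (n : ℕ) (lam : ℝ) : Set ℂ[X] :=
  {F | F ∈ polysWithZerosIn n unitCircle ∧
    ∀ z w : ℂ, ({z, w} : Multiset ℂ) ≤ F.roots → lam < |Complex.arg (z / w)|}

/-- `Im (e^{-inλ/2} F_+(z) / F_-(z))`. At a zero of `F_-` Lean's division gives the value `0`, so
requiring this quantity to be positive excludes the zeros of `F_-`. -/
def imQuotient (n : ℕ) (lam : ℝ) (F : ℂ[X]) (z : ℂ) : ℝ :=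
  (Complex.exp (-(Complex.I * n * lam / 2)) *
    ((plusRot lam F).eval z / (minusRot lam F).eval z)).im

/-- The class `closed-D_n(lam)`, for `0 < lam < 2π/n`. -/
def closedD (n : ℕ) (lam : ℝ) : Set ℂ[X] :=
  {F | F.degree = n ∧ ∀ z : ℂ, 1 < ‖z‖ → 0 < imQuotient n lam F z}

/-- The class `D_n(lam)`, for `0 < lam < 2π/n`. -/
def openD (n : ℕ) (lam : ℝ) : Set ℂ[X] :=
  openT n lam ∪ {F | F.degree = n ∧ ∀ z : ℂ, 1 ≤ ‖z‖ → 0 < imQuotient n lam F z}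

/-- All zeros of `U` on the unit circle have (finite) even order. The zero polynomial does not
have this property, its zeros being of infinite order. -/
def CircleZerosEven (U : ℂ[X]) : Prop :=
  U ≠ 0 ∧ ∀ z ∈ unitCircle, U.IsRoot z → Even (U.rootMultiplicity z)

open Classical in
/-- `U` has exactly `m` critical points in `K`, counted with multiplicity. A constant
polynomial does not have this property, all points being critical points of it. -/
def HasExactlyCriticalPoints (U : ℂ[X]) (K : Set ℂ) (m : ℕ) : Prop :=
  U.derivative ≠ 0 ∧ U.derivative.roots.countP (fun z => z ∈ K) = m

end

/-!
On the unit circle, `T(z) = 2i z^n ρ(z)` with the real number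
`ρ = Im (e^{-inλ/2} F_+ conj F_-)` (`eval_wronskian`), the numerator of the quantity that defines
the classes. The form `(A, B) ↦ A_+ B_- - A_- B_+` is bilinear and alternating, and
`F^{*n} = c_P² P - c_Q² Q`, so `T = (c_P² - c_Q²) S` (`wronskian_eq_C_mul`). Hence everything is a
statement about the sign of `ρ`, for one polynomial `U`, equal to `S` or `T`, with
`U(e^{it}) = κ e^{int} ρ(e^{it})` (`IsRealOnCircle`).

*Even orders.* If `ρ ≥ 0`, the zeros of `U` on the circle have even order; conversely, if they have
even order, `ρ` has a constant sign. If the zeros of `F` lie in the open disk,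
`f = e^{-inλ/2} F_+ / F_-` is holomorphic for `|z| ≥ 1` with `Im f(∞) = sin (nλ/2) > 0`, and the
maximum principle turns the constant sign of `ρ` into `Im f > 0` for `|z| > 1`
(`imQuotient_pos_of_sign`).

*Nonvanishing of `T`.* If `T = 0`, the zeros of `F` in the open disk are invariant under rotation
by `λ`, and there is no room for such an orbit as `nλ < 2π`; so all zeros lie on the circle
(`norm_eq_one_of_wronskian_eq_zero`). In the closed class they are then separated by at least `λ`:
`f` is a product of `n` Möbius transformations mapping `|z| > 1` to the upper half plane, the sum of
whose arguments starts from `nλ/2 < π` at infinity and may not reach `π`, whereas two zeros at an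
angle below `λ` would make it exceed `π` (`le_abs_arg_of_mem_closedD`).

*Critical points.* As `ρ` is real, `Re (z U' / U) = n` on the circle off the zeros of `U`. Averaging
over the circle shows that `U` has `n - M / 2` zeros in the open disk if it has `M` on the circle,
and comparing `U` with `z U'` on a slightly larger circle, where `Re (z U' / U) > 0`, shows that
`U'` has `n - 1 + M / 2` zeros in the closed disk. So `n - 1` critical points there mean that `ρ`
has no zeros.
-/

open Filter Topology

/-! ### Rotations and the `n`-inverse -/

theorem eval_plusRot (lam : ℝ) (F : ℂ[X]) (z : ℂ) :
    (plusRot lam F).eval z = F.eval (Complex.exp (Complex.I * lam / 2) * z) := by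
  simp [plusRot, rotate, mul_div_assoc]

theorem eval_minusRot (lam : ℝ) (F : ℂ[X]) (z : ℂ) :
    (minusRot lam F).eval z = F.eval (Complex.exp (-(Complex.I * lam / 2)) * z) := by
  simp [minusRot, rotate, mul_div_assoc]

theorem plusRot_sub (lam : ℝ) (F G : ℂ[X]) :
    plusRot lam (F - G) = plusRot lam F - plusRot lam G := by
  simp [plusRot, rotate]

theorem minusRot_sub (lam : ℝ) (F G : ℂ[X]) :
    minusRot lam (F - G) = minusRot lam F - minusRot lam G := by
  simp [minusRot, rotate]

theorem plusRot_C_mul (lam : ℝ) (a : ℂ) (F : ℂ[X]) :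
    plusRot lam (C a * F) = C a * plusRot lam F := by
  simp [plusRot, rotate]

theorem minusRot_C_mul (lam : ℝ) (a : ℂ) (F : ℂ[X]) :
    minusRot lam (C a * F) = C a * minusRot lam F := by
  simp [minusRot, rotate]

theorem norm_exp_half (lam : ℝ) : ‖Complex.exp (Complex.I * lam / 2)‖ = 1 := by
  have := Complex.norm_exp_ofReal_mul_I (lam / 2)
  rw [← this]; congr 2; push_cast; ring

theorem norm_exp_neg_half (lam : ℝ) : ‖Complex.exp (-(Complex.I * lam / 2))‖ = 1 := by
  rw [Complex.exp_neg, norm_inv, norm_exp_half, inv_one]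

theorem conj_exp_half (lam : ℝ) : starRingEnd ℂ (Complex.exp (Complex.I * lam / 2)) =
    Complex.exp (-(Complex.I * lam / 2)) := by
  rw [← Complex.exp_conj]; congr 1; simp [neg_div, Complex.conj_ofNat]

theorem conj_exp_neg_half (lam : ℝ) :
    starRingEnd ℂ (Complex.exp (-(Complex.I * lam / 2))) = Complex.exp (Complex.I * lam / 2) := by
  rw [← conj_exp_half, Complex.conj_conj]

theorem exp_half_mul_exp_neg_half (lam : ℝ) :
    Complex.exp (Complex.I * lam / 2) * Complex.exp (-(Complex.I * lam / 2)) = 1 := by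
  rw [← Complex.exp_add, add_neg_cancel, Complex.exp_zero]

theorem exp_neg_nat_half (n : ℕ) (lam : ℝ) : Complex.exp (-(Complex.I * n * lam / 2)) =
    Complex.exp (-(Complex.I * lam / 2)) ^ n := by
  rw [← Complex.exp_nat_mul]; congr 1; ring

theorem nInverse_sub (n : ℕ) (F G : ℂ[X]) :
    nInverse n (F - G) = nInverse n F - nInverse n G := by
  simp [nInverse, reflect_sub]

theorem nInverse_C_mul (n : ℕ) (a : ℂ) (F : ℂ[X]) :
    nInverse n (C a * F) = C (starRingEnd ℂ a) * nInverse n F := by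
  simp [nInverse, reflect_C_mul]

theorem eval_nInverse {n : ℕ} {F : ℂ[X]} (hF : F.natDegree ≤ n) {z : ℂ} (hz : z ≠ 0) :
    (nInverse n F).eval z = z ^ n * starRingEnd ℂ (F.eval (starRingEnd ℂ z)⁻¹) := by
  have hd : (F.map (starRingEnd ℂ)).natDegree ≤ n := natDegree_map_le.trans hF
  let i : Invertible z := invertibleOfNonzero hz
  let j : Invertible z⁻¹ := invertibleOfNonzero (inv_ne_zero hz)
  have h := eval₂_reflect_mul_pow (RingHom.id ℂ) z⁻¹ n (F.map (starRingEnd ℂ)) hd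
  have e : (⅟ (z⁻¹) : ℂ) = z := by simp
  rw [e] at h
  have hc : starRingEnd ℂ (F.eval (starRingEnd ℂ z)⁻¹) =
      (F.map (starRingEnd ℂ)).eval z⁻¹ := by
    rw [← Polynomial.eval₂_at_apply, eval₂_eq_eval_map]
    simp
  rw [hc, nInverse]
  simp only [eval₂_id] at h
  rw [← h, mul_left_comm, ← mul_pow, mul_inv_cancel₀ hz, one_pow, mul_one]

theorem eval_nInverse_of_norm_eq_one {n : ℕ} {F : ℂ[X]} (hF : F.natDegree ≤ n) {z : ℂ}
    (hz : ‖z‖ = 1) : (nInverse n F).eval z = z ^ n * starRingEnd ℂ (F.eval z) := by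
  have h0 : z ≠ 0 := by rintro rfl; simp at hz
  rw [eval_nInverse hF h0, ← map_inv₀, Complex.inv_eq_conj hz, Complex.conj_conj]

theorem eval_zero_nInverse (n : ℕ) (F : ℂ[X]) :
    (nInverse n F).eval 0 = starRingEnd ℂ (F.coeff n) := by
  rw [← coeff_zero_eq_eval_zero, nInverse, coeff_reflect, revAt_le n.zero_le]
  simp

/-- The numerator `Im (e^{-inλ/2} F_+(z) conj (F_-(z)))` of `imQuotient`, which is defined without
a division. -/
noncomputable def imProduct (n : ℕ) (lam : ℝ) (F : ℂ[X]) (z : ℂ) : ℝ :=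
  (Complex.exp (-(Complex.I * n * lam / 2)) *
    ((plusRot lam F).eval z * starRingEnd ℂ ((minusRot lam F).eval z))).im

theorem imQuotient_eq_div (n : ℕ) (lam : ℝ) (F : ℂ[X]) (z : ℂ) :
    imQuotient n lam F z = imProduct n lam F z / Complex.normSq ((minusRot lam F).eval z) := by
  rw [imQuotient, imProduct, div_eq_mul_inv ((plusRot lam F).eval z), Complex.inv_def,
    ← mul_assoc ((plusRot lam F).eval z), ← mul_assoc (Complex.exp _),
    Complex.im_mul_ofReal]
  exact (div_eq_mul_inv _ _).symm

theorem imQuotient_pos_iff (n : ℕ) (lam : ℝ) (F : ℂ[X]) (z : ℂ) :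
    0 < imQuotient n lam F z ↔ 0 < imProduct n lam F z := by
  rw [imQuotient_eq_div]
  constructor
  · intro h
    by_contra hn
    exact absurd h (not_lt.2 (div_nonpos_of_nonpos_of_nonneg (not_lt.1 hn)
      (Complex.normSq_nonneg _)))
  · intro h
    refine div_pos h (Complex.normSq_pos.2 fun h0 => ?_)
    simp [imProduct, h0] at h

theorem continuous_imProduct (n : ℕ) (lam : ℝ) (F : ℂ[X]) : Continuous (imProduct n lam F) := by
  unfold imProduct
  exact Complex.continuous_im.comp (continuous_const.mul ((Polynomial.continuous _).mul
    (Complex.continuous_conj.comp (Polynomial.continuous _))))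

/-- On the unit circle, `F_+ (F^{*n})_- - F_- (F^{*n})_+` is `2i z^n` times a real number. -/
theorem eval_wronskian {n : ℕ} {F : ℂ[X]} (hF : F.natDegree ≤ n) (lam : ℝ) {z : ℂ}
    (hz : ‖z‖ = 1) :
    (plusRot lam F * minusRot lam (nInverse n F)
      - minusRot lam F * plusRot lam (nInverse n F)).eval z =
      2 * Complex.I * z ^ n * imProduct n lam F z := by
  have h1 : ‖Complex.exp (Complex.I * lam / 2) * z‖ = 1 := by
    rw [norm_mul, norm_exp_half, hz, one_mul]
  have h2 : ‖Complex.exp (-(Complex.I * lam / 2)) * z‖ = 1 := by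
    rw [norm_mul, norm_exp_neg_half, hz, one_mul]
  rw [eval_sub, eval_mul, eval_mul, eval_plusRot lam (nInverse n F),
    eval_minusRot lam (nInverse n F), eval_nInverse_of_norm_eq_one hF h1,
    eval_nInverse_of_norm_eq_one hF h2, ← eval_plusRot, ← eval_minusRot]
  set a := (plusRot lam F).eval z
  set b := (minusRot lam F).eval z
  have key := Complex.sub_conj (Complex.exp (-(Complex.I * n * lam / 2)) * (a * starRingEnd ℂ b))
  have : imProduct n lam F z =
    (Complex.exp (-(Complex.I * n * lam / 2)) * (a * starRingEnd ℂ b)).im := rfl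
  rw [this]
  simp only [map_mul, Complex.conj_conj, exp_neg_nat_half, map_pow, conj_exp_neg_half] at key ⊢
  push_cast at key
  linear_combination z ^ n * key

/-! ### Polynomials with a real-valued quotient by `z^n` on the unit circle -/


/-- `U(e^{it}) = κ e^{int} ρ(t)` for all real `t`, with a constant `κ ≠ 0` and a real-valued
function `ρ`. -/
structure IsRealOnCircle (n : ℕ) (κ : ℂ) (ρ : ℝ → ℝ) (U : ℂ[X]) : Prop where
  const_ne_zero : κ ≠ 0
  eval_eq : ∀ t : ℝ, U.eval (Complex.exp (t * Complex.I)) =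
    κ * Complex.exp (t * Complex.I) ^ n * ρ t

theorem exists_eq_exp_of_norm_eq_one {z : ℂ} (hz : ‖z‖ = 1) :
    ∃ t : ℝ, z = Complex.exp (t * Complex.I) := by
  obtain ⟨t, ht⟩ := (Complex.norm_eq_one_iff z).1 hz
  exact ⟨t, ht.symm⟩

namespace IsRealOnCircle

variable {n : ℕ} {κ : ℂ} {ρ : ℝ → ℝ} {U : ℂ[X]}

theorem ofReal_eq (h : IsRealOnCircle n κ ρ U) (t : ℝ) : (ρ t : ℂ) =
    κ⁻¹ * Complex.exp (-(t * Complex.I)) ^ n * U.eval (Complex.exp (t * Complex.I)) := by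
  rw [h.eval_eq t]
  have e : Complex.exp (-(t * Complex.I)) ^ n * Complex.exp (t * Complex.I) ^ n = 1 := by
    rw [← mul_pow, ← Complex.exp_add]; simp
  have := inv_mul_cancel₀ h.const_ne_zero
  linear_combination (-(ρ t : ℂ) * κ⁻¹ * κ) * e - (ρ t : ℂ) * this

theorem continuous (h : IsRealOnCircle n κ ρ U) : Continuous ρ := by
  have e : ρ = fun t : ℝ => (κ⁻¹ * Complex.exp (-(t * Complex.I)) ^ n *
      U.eval (Complex.exp (t * Complex.I))).re := by
    funext t
    rw [← h.ofReal_eq t, Complex.ofReal_re]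
  rw [e]
  have := U.continuous
  fun_prop

theorem isRoot_iff (h : IsRealOnCircle n κ ρ U) (t : ℝ) :
    U.IsRoot (Complex.exp (t * Complex.I)) ↔ ρ t = 0 := by
  rw [IsRoot.def, h.eval_eq t]
  simp [h.const_ne_zero]

/-- Near a point `e^{it₀}` at which `U` has a zero of order `m`, the function `ρ(t₀ + s)` behaves
like a nonzero real multiple of `(2 sin (s/2))^m`. -/
theorem exists_tendsto_div_sin_pow (h : IsRealOnCircle n κ ρ U) (hU : U ≠ 0) (t₀ : ℝ) :
    ∃ c : ℝ, c ≠ 0 ∧ Tendsto (fun s : ℝ => ρ (t₀ + s) /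
      (2 * Real.sin (s / 2)) ^ U.rootMultiplicity (Complex.exp (t₀ * Complex.I)))
      (𝓝[≠] 0) (𝓝 c) := by
  set w := Complex.exp (t₀ * Complex.I) with hw
  obtain ⟨V, hV, hVw⟩ := exists_eq_pow_rootMultiplicity_mul_and_not_dvd U hU w
  set m := U.rootMultiplicity w
  rw [dvd_iff_isRoot] at hVw
  -- the quotient in the statement, with the vanishing factors cancelled
  let H : ℝ → ℂ := fun s => κ⁻¹ * Complex.exp (-((t₀ + s : ℝ) * Complex.I)) ^ n *
    ((w * Complex.exp (s / 2 * Complex.I) * Complex.I) ^ m *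
      V.eval (w * Complex.exp (s * Complex.I)))
  have hH : Continuous H := by
    have := V.continuous
    fun_prop
  have hsin : ∀ᶠ s : ℝ in 𝓝[≠] 0, Real.sin (s / 2) ≠ 0 := by
    have : Set.Ioo (-1 : ℝ) 1 ∈ 𝓝 (0 : ℝ) := Ioo_mem_nhds (by norm_num) (by norm_num)
    filter_upwards [mem_nhdsWithin_of_mem_nhds this, self_mem_nhdsWithin] with s hs hs0 h0
    have := (Real.sin_eq_zero_iff_of_lt_of_lt (by linarith [hs.1, Real.pi_gt_three])
      (by linarith [hs.2, Real.pi_gt_three])).1 h0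
    exact hs0 (by simpa using this)
  have hev : ∀ᶠ s : ℝ in 𝓝[≠] 0,
      ((ρ (t₀ + s) / (2 * Real.sin (s / 2)) ^ m : ℝ) : ℂ) = H s := by
    filter_upwards [hsin] with s hs
    have e1 : Complex.exp ((t₀ + s : ℝ) * Complex.I) = w * Complex.exp (s * Complex.I) := by
      rw [hw, ← Complex.exp_add]; congr 1; push_cast; ring
    have e2 : w * Complex.exp (s * Complex.I) - w =
        (w * Complex.exp (s / 2 * Complex.I) * Complex.I) * (2 * Complex.sin (s / 2)) := by
      have e3 : Complex.exp (s * Complex.I) = Complex.exp (s / 2 * Complex.I) ^ 2 := by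
        rw [← Complex.exp_nat_mul]; congr 1; push_cast; ring
      have e4 : Complex.exp (-(s / 2) * Complex.I) * Complex.exp (s / 2 * Complex.I) = 1 := by
        rw [← Complex.exp_add]; simp
      rw [Complex.sin, e3]
      linear_combination w * e4 - w * Complex.exp (s / 2 * Complex.I) *
        (Complex.exp (-(s / 2) * Complex.I) - Complex.exp (s / 2 * Complex.I)) * Complex.I_mul_I
    have hs' : (2 * Complex.sin (s / 2)) ≠ 0 := by
      have : ((2 * Real.sin (s / 2) : ℝ) : ℂ) ≠ 0 := by
        exact_mod_cast mul_ne_zero two_ne_zero hs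
      push_cast at this
      exact this
    push_cast
    rw [div_eq_iff (pow_ne_zero _ hs'), h.ofReal_eq, e1]
    conv_lhs => rw [hV]
    rw [eval_mul, eval_pow, eval_sub, eval_X, eval_C, e2, mul_pow]
    simp only [H]
    ring
  have hlim : Tendsto (fun s : ℝ => ((ρ (t₀ + s) / (2 * Real.sin (s / 2)) ^ m : ℝ) : ℂ))
      (𝓝[≠] 0) (𝓝 (H 0)) :=
    ((hH.tendsto 0).mono_left nhdsWithin_le_nhds).congr' (hev.mono fun _ => Eq.symm)
  have hre := (Complex.continuous_re.tendsto _).comp hlim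
  have him := (Complex.continuous_im.tendsto _).comp hlim
  have him0 : (H 0).im = 0 := by
    refine tendsto_nhds_unique him ?_
    simp only [Function.comp_def, Complex.ofReal_im]
    exact tendsto_const_nhds
  have hH0 : H 0 ≠ 0 := by
    have : w ≠ 0 := Complex.exp_ne_zero _
    have : V.eval w ≠ 0 := hVw
    simp only [H]
    simp [h.const_ne_zero, *, -hw]
  refine ⟨(H 0).re, fun h0 => hH0 (Complex.ext h0 him0), ?_⟩
  simpa only [Function.comp_def, Complex.ofReal_re] using hre

theorem eventually_ne_zero (h : IsRealOnCircle n κ ρ U) (hU : U ≠ 0) (t₀ : ℝ) :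
    ∀ᶠ t in 𝓝[≠] t₀, ρ t ≠ 0 := by
  obtain ⟨c, hc, hlim⟩ := h.exists_tendsto_div_sin_pow hU t₀
  have h1 : ∀ᶠ s : ℝ in 𝓝[≠] 0, ρ (t₀ + s) ≠ 0 := by
    filter_upwards [hlim.eventually_ne hc] with s hs h0
    simp [h0] at hs
  have h2 : Tendsto (fun t : ℝ => t - t₀) (𝓝[≠] t₀) (𝓝[≠] 0) := by
    refine tendsto_nhdsWithin_iff.2 ⟨?_, ?_⟩
    · have : Continuous fun t : ℝ => t - t₀ := by fun_prop
      simpa using (this.tendsto t₀).mono_left nhdsWithin_le_nhds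
    · filter_upwards [self_mem_nhdsWithin] with t ht
      exact sub_ne_zero.2 ht
  filter_upwards [h2.eventually h1] with t ht
  simpa using ht

theorem circleZerosEven_of_nonneg (h : IsRealOnCircle n κ ρ U) (hU : U ≠ 0)
    (hρ : ∀ t, 0 ≤ ρ t) : CircleZerosEven U := by
  refine ⟨hU, fun z hz _ => ?_⟩
  obtain ⟨t, rfl⟩ := exists_eq_exp_of_norm_eq_one hz
  obtain ⟨c, hc, hlim⟩ := h.exists_tendsto_div_sin_pow hU t
  by_contra hodd
  rw [Nat.not_even_iff_odd] at hodd
  -- for odd order the two one-sided limits of the quotient have opposite signs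
  have hR : 0 ≤ c := by
    have hle : 𝓝[>] (0 : ℝ) ≤ 𝓝[≠] 0 := nhdsWithin_mono _ fun x hx => ne_of_gt hx
    refine ge_of_tendsto (hlim.mono_left hle) ?_
    filter_upwards [Ioo_mem_nhdsGT (zero_lt_one' ℝ)] with s hs
    have : 0 ≤ Real.sin (s / 2) := Real.sin_nonneg_of_nonneg_of_le_pi (by linarith [hs.1])
      (by linarith [hs.2, Real.pi_gt_three])
    have := hρ (t + s)
    positivity
  have hL : c ≤ 0 := by
    have hle : 𝓝[<] (0 : ℝ) ≤ 𝓝[≠] 0 := nhdsWithin_mono _ fun x hx => ne_of_lt hx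
    refine le_of_tendsto (hlim.mono_left hle) ?_
    filter_upwards [Ioo_mem_nhdsLT (show (-1 : ℝ) < 0 by norm_num)] with s hs
    have : Real.sin (s / 2) ≤ 0 := Real.sin_nonpos_of_nonpos_of_neg_pi_le (by linarith [hs.2])
      (by linarith [hs.1, Real.pi_gt_three])
    exact div_nonpos_of_nonneg_of_nonpos (hρ _) (hodd.pow_nonpos (by linarith))
  exact hc (le_antisymm hL hR)

/-- If all zeros on the circle have even order, `ρ` does not change its sign: each point has a
punctured neighbourhood on which `ρ` is positive or one on which it is negative, and the line is
connected. -/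
theorem nonneg_or_nonpos_of_circleZerosEven (h : IsRealOnCircle n κ ρ U)
    (hU : CircleZerosEven U) : (∀ t, 0 ≤ ρ t) ∨ ∀ t, ρ t ≤ 0 := by
  let A : Set ℝ := {t | ∀ᶠ s in 𝓝[≠] t, 0 < ρ s}
  let B : Set ℝ := {t | ∀ᶠ s in 𝓝[≠] t, ρ s < 0}
  have hopen : ∀ p : ℝ → Prop, IsOpen {t | p t} → IsOpen {t | ∀ᶠ s in 𝓝[≠] t, p s} := by
    intro p hp
    refine isOpen_iff_mem_nhds.2 fun t ht => ?_
    have h2 : ∀ᶠ x in 𝓝[≠] t, ∀ᶠ s in 𝓝[≠] x, p s := by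
      filter_upwards [ht] with x hx
      exact mem_nhdsWithin_of_mem_nhds (hp.mem_nhds hx)
    rw [eventually_nhdsWithin_iff] at h2
    filter_upwards [h2] with x hx
    by_cases hxt : x = t
    · subst hxt; exact ht
    · exact hx hxt
  have hA : IsOpen A := hopen _ (isOpen_lt continuous_const h.continuous)
  have hB : IsOpen B := hopen _ (isOpen_lt h.continuous continuous_const)
  have hAB : ∀ t, t ∈ A ∨ t ∈ B := by
    intro t
    obtain ⟨c, hc, hlim⟩ := h.exists_tendsto_div_sin_pow hU.1 t
    have heven : Even (U.rootMultiplicity (Complex.exp (t * Complex.I))) := by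
      by_cases hr : U.IsRoot (Complex.exp (t * Complex.I))
      · exact hU.2 _ (Complex.norm_exp_ofReal_mul_I t) hr
      · rw [rootMultiplicity_eq_zero hr]; exact Even.zero
    have h2 : Tendsto (fun x : ℝ => x - t) (𝓝[≠] t) (𝓝[≠] 0) := by
      refine tendsto_nhdsWithin_iff.2 ⟨?_, ?_⟩
      · have : Continuous fun x : ℝ => x - t := by fun_prop
        simpa using (this.tendsto t).mono_left nhdsWithin_le_nhds
      · filter_upwards [self_mem_nhdsWithin] with x hx
        exact sub_ne_zero.2 hx
    have hlim' := hlim.comp h2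
    rcases lt_or_gt_of_ne hc with hneg | hpos
    · right
      filter_upwards [hlim'.eventually_lt_const hneg] with s hs
      by_contra hcon
      rw [not_lt] at hcon
      refine absurd hs (not_lt.2 (div_nonneg ?_ (heven.pow_nonneg _)))
      simpa using hcon
    · left
      filter_upwards [hlim'.eventually_const_lt hpos] with s hs
      by_contra hcon
      rw [not_lt] at hcon
      refine absurd hs (not_lt.2 (div_nonpos_of_nonpos_of_nonneg ?_ (heven.pow_nonneg _)))
      simpa using hcon
  have hdisj : ∀ t, t ∈ A → t ∈ B → False := by
    intro t ha hb
    obtain ⟨s, hs1, hs2⟩ := (Filter.Eventually.and (f := 𝓝[≠] t) ha hb).exists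
    exact lt_asymm hs1 hs2
  have hclopen : IsClopen A := by
    refine ⟨⟨?_⟩, hA⟩
    have : Aᶜ = B := by
      ext t
      exact ⟨fun hn => (hAB t).resolve_left hn, fun hb ha => hdisj t ha hb⟩
    rw [this]; exact hB
  rcases isClopen_iff.1 hclopen with hAe | hAu
  · right
    intro t
    have hb : t ∈ B := (hAB t).resolve_left (by rw [hAe]; exact Set.notMem_empty t)
    exact le_of_tendsto ((h.continuous.tendsto t).mono_left nhdsWithin_le_nhds)
      (Eventually.mono hb fun _ => le_of_lt)
  · left
    intro t
    have ha : t ∈ A := by rw [hAu]; exact Set.mem_univ t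
    exact ge_of_tendsto ((h.continuous.tendsto t).mono_left nhdsWithin_le_nhds)
      (Eventually.mono ha fun _ => le_of_lt)

end IsRealOnCircle

/-! ### Counting zeros in disks -/

theorem circleIntegral_sum_inv_sub {r : ℝ} (hr : 0 < r) (s : Multiset ℂ)
    (hs : ∀ a ∈ s, ‖a‖ ≠ r) :
    CircleIntegrable (fun z => (s.map fun a => 1 / (z - a)).sum) 0 r ∧
    (∮ z in C(0, r), (s.map fun a => 1 / (z - a)).sum) =
      2 * Real.pi * Complex.I * (s.countP fun a => ‖a‖ < r) := by
  induction s using Multiset.induction_on with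
  | empty => simp [circleIntegral]
  | cons a s ih =>
    obtain ⟨ih1, ih2⟩ := ih fun b hb => hs b (Multiset.mem_cons_of_mem hb)
    have ha : ‖a‖ ≠ r := hs a (Multiset.mem_cons_self a s)
    have hcont : ∀ K : Set ℂ, a ∉ K → DifferentiableOn ℂ (fun z => 1 / (z - a)) K :=
      fun K hK z hz => ((differentiableAt_const 1).div
        (differentiableAt_id.sub (differentiableAt_const a))
        (sub_ne_zero.2 (ne_of_mem_of_not_mem hz hK))).differentiableWithinAt
    have hint : CircleIntegrable (fun z => 1 / (z - a)) 0 r :=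
      ((hcont (Metric.sphere 0 r) (by simpa using ha)).continuousOn).circleIntegrable hr.le
    simp only [Multiset.map_cons, Multiset.sum_cons]
    refine ⟨hint.add ih1, ?_⟩
    rw [circleIntegral.integral_add hint ih1, ih2, Multiset.countP_cons]
    by_cases hlt : ‖a‖ < r
    · have := circleIntegral.integral_sub_inv_of_mem_ball (c := 0) (R := r) (w := a)
        (by simpa using hlt)
      simp only [one_div, this, hlt, if_true]
      push_cast
      ring
    · have hout : a ∉ Metric.closedBall (0 : ℂ) r := by
        simpa using lt_of_le_of_ne (not_lt.1 hlt) ha.symm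
      have : (∮ z in C(0, r), 1 / (z - a)) = 0 :=
        ((hcont _ hout).mono Metric.closure_ball_subset_closedBall).diffContOnCl
          |>.circleIntegral_eq_zero hr.le
      rw [this, zero_add, if_neg hlt, add_zero]

theorem eval_derivative_div_eval {p : ℂ[X]} {z : ℂ} (hz : p.eval z ≠ 0) :
    p.derivative.eval z / p.eval z = (p.roots.map fun a => 1 / (z - a)).sum :=
  (IsAlgClosed.splits p).eval_derivative_div_eval_of_ne_zero hz

theorem circleIntegral_logDeriv {r : ℝ} (hr : 0 < r) {p : ℂ[X]}
    (hp : ∀ z : ℂ, ‖z‖ = r → p.eval z ≠ 0) :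
    CircleIntegrable (fun z => p.derivative.eval z / p.eval z) 0 r ∧
    (∮ z in C(0, r), p.derivative.eval z / p.eval z) =
      2 * Real.pi * Complex.I * (p.roots.countP fun a => ‖a‖ < r) := by
  have h := circleIntegral_sum_inv_sub hr p.roots fun a ha har =>
    hp a har (isRoot_of_mem_roots ha)
  have e : Set.EqOn (fun z => (p.roots.map fun a => 1 / (z - a)).sum)
      (fun z => p.derivative.eval z / p.eval z) (Metric.sphere 0 r) := by
    intro z hz
    exact (eval_derivative_div_eval (hp z (by simpa using hz))).symm
  refine ⟨?_, ?_⟩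
  · refine ContinuousOn.circleIntegrable hr.le ?_
    exact p.derivative.continuous.continuousOn.div p.continuous.continuousOn fun z hz =>
      hp z (by simpa using hz)
  · rw [← h.2]
    exact circleIntegral.integral_congr hr.le fun z hz => (e hz).symm

/-- A version of Rouché's theorem: two polynomials whose quotient avoids the closed negative real
axis on `|z| = r` have equally many zeros in `|z| < r`, because the difference of their logarithmic
derivatives has the primitive `log (q / p)` along the circle. -/
theorem countP_roots_eq_of_div_mem_slitPlane {r : ℝ} (hr : 0 < r) {p q : ℂ[X]}
    (h : ∀ z : ℂ, ‖z‖ = r → q.eval z / p.eval z ∈ Complex.slitPlane) :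
    q.roots.countP (fun a => ‖a‖ < r) = p.roots.countP fun a => ‖a‖ < r := by
  have hp : ∀ z : ℂ, ‖z‖ = r → p.eval z ≠ 0 := fun z hz h0 => by
    simpa [h0] using h z hz
  have hq : ∀ z : ℂ, ‖z‖ = r → q.eval z ≠ 0 := fun z hz h0 => by
    simpa [h0] using h z hz
  obtain ⟨ip, ep⟩ := circleIntegral_logDeriv hr hp
  obtain ⟨iq, eq⟩ := circleIntegral_logDeriv hr hq
  have h0 : (∮ z in C(0, r), (q.derivative.eval z / q.eval z -
      p.derivative.eval z / p.eval z)) = 0 := by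
    refine circleIntegral.integral_eq_zero_of_hasDerivWithinAt
      (f := fun z => Complex.log (q.eval z / p.eval z)) hr.le fun z hz => ?_
    have hz : ‖z‖ = r := by simpa using hz
    have hd := ((q.hasDerivAt z).div (p.hasDerivAt z) (hp z hz)).clog (h z hz)
    refine (hd.congr_deriv ?_).hasDerivWithinAt
    have h1 := hp z hz
    have h2 := hq z hz
    simp only [Pi.div_apply]
    field_simp
  rw [circleIntegral.integral_sub iq ip, ep, eq, sub_eq_zero] at h0
  have := mul_left_cancel₀ Complex.two_pi_I_ne_zero h0
  exact_mod_cast this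

theorem countP_roots_X_mul_derivative {U : ℂ[X]} (hU : U.derivative ≠ 0) (p : ℂ → Prop) [DecidablePred p]
    (hp : p 0) :
    (X * U.derivative).roots.countP p = U.derivative.roots.countP p + 1 := by
  rw [roots_mul (mul_ne_zero X_ne_zero hU), roots_X, Multiset.countP_add, add_comm]
  congr 1
  have : ({0} : Multiset ℂ) = 0 ::ₘ 0 := rfl
  rw [this, Multiset.countP_cons_of_pos _ hp, Multiset.countP_zero]

theorem exists_one_add_le_norm (s : Multiset ℂ) :
    ∃ δ > 0, ∀ a ∈ s, 1 < ‖a‖ → 1 + δ ≤ ‖a‖ := by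
  induction s using Multiset.induction_on with
  | empty => exact ⟨1, one_pos, by simp⟩
  | cons a s ih =>
    obtain ⟨δ, hδ, h⟩ := ih
    by_cases ha : 1 < ‖a‖
    · refine ⟨min δ (‖a‖ - 1), lt_min hδ (by linarith), fun b hb hb1 => ?_⟩
      rcases Multiset.mem_cons.1 hb with rfl | hb
      · linarith [min_le_right δ (‖b‖ - 1)]
      · linarith [min_le_left δ (‖a‖ - 1), h b hb hb1]
    · refine ⟨δ, hδ, fun b hb hb1 => ?_⟩
      rcases Multiset.mem_cons.1 hb with rfl | hb
      · exact absurd hb1 ha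
      · exact h b hb hb1

/-! ### Critical points of polynomials that are real on the circle -/

theorem re_div_sub (z a : ℂ) (h : z ≠ a) : (z / (z - a)).re =
    1 / 2 + (‖z‖ ^ 2 - ‖a‖ ^ 2) / (2 * Complex.normSq (z - a)) := by
  have h0 : Complex.normSq (z - a) ≠ 0 := by simpa [sub_eq_zero] using h
  rw [Complex.div_re]
  field_simp
  rw [← Complex.normSq_eq_norm_sq, ← Complex.normSq_eq_norm_sq]
  simp only [Complex.normSq_apply, Complex.sub_re, Complex.sub_im]
  ring

theorem re_sum_div_sub_ge (s : Multiset ℂ) (hs : ∀ a ∈ s, ‖a‖ = 1) {z : ℂ} (hz : 1 ≤ ‖z‖)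
    (hzs : z ∉ s) : (s.card : ℝ) / 2 ≤ ((s.map fun a => z / (z - a)).sum).re := by
  induction s using Multiset.induction_on with
  | empty => simp
  | cons a s ih =>
    rw [Multiset.mem_cons, not_or] at hzs
    have := ih (fun b hb => hs b (Multiset.mem_cons_of_mem hb)) hzs.2
    have ha := hs a (Multiset.mem_cons_self a s)
    have h2 : 0 ≤ (‖z‖ ^ 2 - ‖a‖ ^ 2) / (2 * Complex.normSq (z - a)) := by
      refine div_nonneg ?_ (mul_nonneg zero_le_two (Complex.normSq_nonneg _))
      rw [ha]; nlinarith
    rw [Multiset.map_cons, Multiset.sum_cons, Complex.add_re, re_div_sub z a hzs.1,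
      Multiset.card_cons]
    push_cast
    linarith

theorem re_sum_div_sub_eq (s : Multiset ℂ) (hs : ∀ a ∈ s, ‖a‖ = 1) {z : ℂ} (hz : ‖z‖ = 1)
    (hzs : z ∉ s) : ((s.map fun a => z / (z - a)).sum).re = (s.card : ℝ) / 2 := by
  induction s using Multiset.induction_on with
  | empty => simp
  | cons a s ih =>
    rw [Multiset.mem_cons, not_or] at hzs
    have := ih (fun b hb => hs b (Multiset.mem_cons_of_mem hb)) hzs.2
    have ha := hs a (Multiset.mem_cons_self a s)
    rw [Multiset.map_cons, Multiset.sum_cons, Complex.add_re, re_div_sub z a hzs.1,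
      Multiset.card_cons, this, ha, hz]
    push_cast
    ring

theorem continuousAt_sum_div_sub (s : Multiset ℂ) {z : ℂ} (hz : z ∉ s) :
    ContinuousAt (fun z => (s.map fun a => z / (z - a)).sum) z := by
  induction s using Multiset.induction_on with
  | empty => simpa using continuousAt_const
  | cons a s ih =>
    rw [Multiset.mem_cons, not_or] at hz
    simp only [Multiset.map_cons, Multiset.sum_cons]
    exact (continuousAt_id.div (continuousAt_id.sub continuousAt_const)
      (sub_ne_zero.2 hz.1)).add (ih hz.2)

theorem mul_eval_derivative_div_eval {p : ℂ[X]} {z : ℂ} (hz : p.eval z ≠ 0) :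
    z * p.derivative.eval z / p.eval z = (p.roots.map fun a => z / (z - a)).sum := by
  rw [mul_div_assoc, eval_derivative_div_eval hz, ← Multiset.sum_map_mul_left]
  simp only [mul_one_div]

namespace IsRealOnCircle

variable {n : ℕ} {κ : ℂ} {ρ : ℝ → ℝ} {U : ℂ[X]}

/-- The derivative of the real-valued function `ρ` is real, which fixes the real part of
`z U'(z) / U(z)` on the circle. -/
theorem re_logDeriv (h : IsRealOnCircle n κ ρ U) {z : ℂ} (hz : ‖z‖ = 1) (hU : U.eval z ≠ 0) :
    (z * U.derivative.eval z / U.eval z).re = n := by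
  obtain ⟨t, rfl⟩ := exists_eq_exp_of_norm_eq_one hz
  set z := Complex.exp (t * Complex.I) with hzdef
  have hz0 : z ≠ 0 := Complex.exp_ne_zero _
  have hρ : (ρ t : ℂ) ≠ 0 := by
    intro h0
    exact hU (by rw [h.eval_eq t, h0, mul_zero])
  -- the derivative of `ρ`, computed from the formula for `ρ` in terms of `U`
  have he : HasDerivAt (fun s : ℝ => Complex.exp (s * Complex.I)) (z * Complex.I) t := by
    have := ((Complex.ofRealCLM.hasDerivAt (x := t)).mul_const Complex.I).cexp
    simpa using this
  have he' : HasDerivAt (fun s : ℝ => Complex.exp (-(s * Complex.I)) ^ n)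
      (-(n * Complex.I) * Complex.exp (-(t * Complex.I)) ^ n) t := by
    have := ((((Complex.ofRealCLM.hasDerivAt (x := t)).mul_const Complex.I).neg.const_mul
      (n : ℂ))).cexp
    have e : (fun s : ℝ => Complex.exp (-(s * Complex.I)) ^ n) =
        fun s : ℝ => Complex.exp (n * -(s * Complex.I)) := by
      funext s; rw [Complex.exp_nat_mul]
    rw [e, ← Complex.exp_nat_mul]
    refine this.congr_deriv ?_
    simp
    ring
  have hd := (he'.const_mul κ⁻¹).mul ((U.hasDerivAt z).comp t he)
  have him := (Complex.imCLM.hasFDerivAt.comp_hasDerivAt t hd)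
  have hzero : (fun s : ℝ => (0 : ℝ)) = (Complex.imCLM ∘
      ((fun s : ℝ => κ⁻¹ * Complex.exp (-(s * Complex.I)) ^ n) *
        ((fun x => eval x U) ∘ fun s : ℝ => Complex.exp (s * Complex.I)))) := by
    funext s
    have := congrArg Complex.im (h.ofReal_eq s)
    simpa using this
  rw [← hzero] at him
  have him0 := him.unique (hasDerivAt_const t (0 : ℝ))
  set L := z * U.derivative.eval z / U.eval z with hL
  have hL' : z * U.derivative.eval z = L * U.eval z := by rw [hL]; field_simp
  have hval : κ⁻¹ * (-(n * Complex.I) * Complex.exp (-(t * Complex.I)) ^ n) * eval z U +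
      κ⁻¹ * Complex.exp (-(t * Complex.I)) ^ n * (U.derivative.eval z * (z * Complex.I)) =
      (ρ t : ℂ) * (Complex.I * (L - n)) := by
    rw [h.ofReal_eq t]
    linear_combination (κ⁻¹ * Complex.exp (-(t * Complex.I)) ^ n * Complex.I) * hL'
  have : ((ρ t : ℂ) * (Complex.I * (L - n))).im = 0 := by
    rw [← hval]
    simpa using him0
  rw [Complex.im_ofReal_mul] at this
  have h1 := (mul_eq_zero.1 this).resolve_left (by exact_mod_cast hρ)
  simp at h1
  linarith

/-- If `ρ` is positive, both `U` and `z U'` wind around the origin as often as `z^n` does. -/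
theorem hasExactlyCriticalPoints_of_pos (h : IsRealOnCircle n κ ρ U) (hn : 1 ≤ n)
    (hρ : ∀ t, 0 < ρ t) : HasExactlyCriticalPoints U openDisk (n - 1) := by
  have hne : ∀ z : ℂ, ‖z‖ = 1 → U.eval z ≠ 0 := by
    intro z hz h0
    obtain ⟨t, rfl⟩ := exists_eq_exp_of_norm_eq_one hz
    exact (hρ t).ne' ((h.isRoot_iff t).1 h0)
  have hd : U.derivative ≠ 0 := by
    intro h0
    have := h.re_logDeriv (z := 1) (by simp) (hne 1 (by simp))
    rw [h0, eval_zero, mul_zero, zero_div, Complex.zero_re] at this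
    have : n = 0 := by exact_mod_cast this.symm
    omega
  refine ⟨hd, ?_⟩
  have c1 : U.roots.countP (fun a => ‖a‖ < 1) = (C κ * X ^ n).roots.countP fun a => ‖a‖ < 1 := by
    refine countP_roots_eq_of_div_mem_slitPlane one_pos fun z hz => ?_
    obtain ⟨t, rfl⟩ := exists_eq_exp_of_norm_eq_one hz
    have h0 : κ * Complex.exp (t * Complex.I) ^ n ≠ 0 :=
      mul_ne_zero h.const_ne_zero (pow_ne_zero _ (Complex.exp_ne_zero _))
    rw [h.eval_eq t, eval_mul, eval_C, eval_pow, eval_X, mul_div_cancel_left₀ _ h0]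
    exact Complex.ofReal_mem_slitPlane.2 (hρ t)
  have c2 : (X * U.derivative).roots.countP (fun a => ‖a‖ < 1) =
      U.roots.countP fun a => ‖a‖ < 1 := by
    refine countP_roots_eq_of_div_mem_slitPlane one_pos fun z hz => ?_
    left
    rw [eval_mul, eval_X, h.re_logDeriv hz (hne z hz)]
    exact_mod_cast hn
  have c3 : (C κ * X ^ n).roots.countP (fun a => ‖a‖ < 1) = n := by
    rw [roots_C_mul _ h.const_ne_zero, roots_X_pow, Multiset.nsmul_singleton,
      Multiset.countP_eq_card.2]
    · simp
    · intro a ha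
      rw [Multiset.eq_of_mem_replicate ha]
      simp
  rw [c1, c3, countP_roots_X_mul_derivative hd _ (by simp)] at c2
  have : U.derivative.roots.countP (fun a => ‖a‖ < 1) = n - 1 := by omega
  rw [← this]
  classical
  exact Multiset.countP_congr rfl fun a _ => rfl

/-- With `M` zeros on the circle, `U` has `n - M / 2` zeros in the open disk: the mean of
`Re (z / (z - a))` over the circle is `1`, `1 / 2` or `0` according to the position of `a`. -/
theorem countP_roots_openDisk (h : IsRealOnCircle n κ ρ U) (hU : U ≠ 0) :
    (∀ z : ℂ, ‖z‖ = 1 → (((U.roots.filter fun a => ¬ ‖a‖ = 1).map fun a => z / (z - a)).sum).re =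
      n - ((U.roots.filter fun a => ‖a‖ = 1).card : ℝ) / 2) ∧
    (U.roots.countP (fun a => ‖a‖ < 1) : ℝ) =
      n - ((U.roots.filter fun a => ‖a‖ = 1).card : ℝ) / 2 := by
  set A := U.roots.filter fun a => ‖a‖ = 1 with hA
  set B := U.roots.filter fun a => ¬ ‖a‖ = 1 with hB
  have hAB : A + B = U.roots := Multiset.filter_add_not _ _
  have hA1 : ∀ a ∈ A, ‖a‖ = 1 := fun a ha => (Multiset.mem_filter.1 ha).2
  have hB1 : ∀ a ∈ B, ‖a‖ ≠ 1 := fun a ha => (Multiset.mem_filter.1 ha).2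
  have hoff : ∀ z : ℂ, ‖z‖ = 1 → U.eval z ≠ 0 →
      ((B.map fun a => z / (z - a)).sum).re = n - (A.card : ℝ) / 2 := by
    intro z hz h0
    have h1 := h.re_logDeriv hz h0
    have hzA : z ∉ A := fun hz' => h0 (isRoot_of_mem_roots (Multiset.mem_filter.1 hz').1)
    rw [mul_eval_derivative_div_eval h0, ← hAB, Multiset.map_add, Multiset.sum_add,
      Complex.add_re, re_sum_div_sub_eq A hA1 hz hzA] at h1
    linarith
  have hcont : ∀ z : ℂ, ‖z‖ = 1 → ContinuousAt (fun z => (B.map fun a => z / (z - a)).sum) z :=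
    fun z hz => continuousAt_sum_div_sub B fun hz' => hB1 z hz' hz
  have hon : ∀ z : ℂ, ‖z‖ = 1 →
      ((B.map fun a => z / (z - a)).sum).re = n - (A.card : ℝ) / 2 := by
    intro z hz
    obtain ⟨t, rfl⟩ := exists_eq_exp_of_norm_eq_one hz
    -- the zeros on the circle are isolated, so the identity extends to them by continuity
    have hc : ContinuousAt (fun s : ℝ => ((B.map fun a => Complex.exp (s * Complex.I) /
        (Complex.exp (s * Complex.I) - a)).sum).re) t := by
      have he : ContinuousAt (fun s : ℝ => Complex.exp (s * Complex.I)) t := by fun_prop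
      exact Complex.continuous_re.continuousAt.comp
        (ContinuousAt.comp (f := fun s : ℝ => Complex.exp (s * Complex.I)) (hcont _ hz) he)
    refine tendsto_nhds_unique (hc.tendsto.mono_left (nhdsWithin_le_nhds (s := {t}ᶜ))) ?_
    refine tendsto_const_nhds.congr' ?_
    filter_upwards [h.eventually_ne_zero hU t] with s hs
    exact (hoff _ (Complex.norm_exp_ofReal_mul_I s) fun h0 => hs ((h.isRoot_iff s).1 h0)).symm
  refine ⟨hon, ?_⟩
  have hcount : U.roots.countP (fun a => ‖a‖ < 1) = B.countP fun a => ‖a‖ < 1 := by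
    rw [← hAB, Multiset.countP_add, Multiset.countP_eq_zero.2, zero_add]
    intro a ha
    simp [hA1 a ha]
  rw [hcount]
  obtain ⟨-, hint⟩ := circleIntegral_sum_inv_sub one_pos B hB1
  have hcont' : Continuous fun θ : ℝ => (B.map fun a => circleMap 0 1 θ /
      (circleMap 0 1 θ - a)).sum := by
    refine continuous_iff_continuousAt.2 fun θ => ?_
    exact ContinuousAt.comp (f := circleMap 0 1) (hcont _ (by simp)) (by fun_prop)
  have hintegral : (∮ z in C(0, 1), (B.map fun a => 1 / (z - a)).sum) =
      Complex.I * ∫ θ in (0 : ℝ)..2 * Real.pi, (B.map fun a => circleMap 0 1 θ /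
        (circleMap 0 1 θ - a)).sum := by
    rw [circleIntegral, ← intervalIntegral.integral_const_mul]
    congr 1
    funext θ
    rw [deriv_circleMap, smul_eq_mul, ← Multiset.sum_map_mul_left, ← Multiset.sum_map_mul_left]
    congr 2
    funext a
    ring
  rw [hintegral] at hint
  have h2 : (∫ θ in (0 : ℝ)..2 * Real.pi, (B.map fun a => circleMap 0 1 θ /
        (circleMap 0 1 θ - a)).sum) = ((2 * Real.pi * (B.countP fun a => ‖a‖ < 1) : ℝ) : ℂ) := by
    refine mul_left_cancel₀ Complex.I_ne_zero ?_
    rw [hint]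
    push_cast
    ring
  have h3 := Complex.reCLM.intervalIntegral_comp_comm
    (hcont'.intervalIntegrable (μ := MeasureTheory.volume) 0 (2 * Real.pi))
  rw [h2] at h3
  have h4 : ∀ θ : ℝ, Complex.reCLM ((B.map fun a => circleMap 0 1 θ /
        (circleMap 0 1 θ - a)).sum) = n - (A.card : ℝ) / 2 := fun θ => hon _ (by simp)
  simp only [h4, intervalIntegral.integral_const, Complex.reCLM_apply, Complex.ofReal_re,
    smul_eq_mul, sub_zero] at h3
  exact (mul_left_cancel₀ (by positivity) h3).symm

/-- On a circle of radius slightly larger than `1`, the real part of `z U'/ U` is positive, so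
`z U'` has as many zeros in the closed unit disk as `U` has, and this number is `n + M / 2` if `U`
has `M` zeros on the unit circle. -/
theorem not_isRoot_of_hasExactlyCriticalPoints (h : IsRealOnCircle n κ ρ U) (hn : 1 ≤ n)
    (hcrit : HasExactlyCriticalPoints U closedDisk (n - 1)) {z : ℂ} (hz : ‖z‖ = 1) :
    ¬ U.IsRoot z := by
  obtain ⟨hd, hcount⟩ := hcrit
  have hU : U ≠ 0 := by rintro rfl; simp at hd
  obtain ⟨hon, hN⟩ := h.countP_roots_openDisk hU
  set A := U.roots.filter fun a => ‖a‖ = 1 with hA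
  set B := U.roots.filter fun a => ¬ ‖a‖ = 1 with hB
  have hAB : A + B = U.roots := Multiset.filter_add_not _ _
  have hA1 : ∀ a ∈ A, ‖a‖ = 1 := fun a ha => (Multiset.mem_filter.1 ha).2
  have hB1 : ∀ a ∈ B, ‖a‖ ≠ 1 := fun a ha => (Multiset.mem_filter.1 ha).2
  obtain ⟨δ₁, hδ₁, h1⟩ := exists_one_add_le_norm (U.roots + U.derivative.roots)
  -- the contribution of the zeros off the circle stays almost constant near the circle
  obtain ⟨δ₂, hδ₂, h2⟩ : ∃ δ > 0, ∀ w : ℂ, 1 ≤ ‖w‖ → ‖w‖ < 1 + δ →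
      n - (A.card : ℝ) / 2 - 1 / 2 < ((B.map fun a => w / (w - a)).sum).re := by
    let V : Set ℂ := {w | ∀ᶠ y in 𝓝 w,
      n - (A.card : ℝ) / 2 - 1 / 2 < ((B.map fun a => y / (y - a)).sum).re}
    have hV : IsOpen V := isOpen_setOfPred_eventually_nhds
    have hsub : Metric.sphere (0 : ℂ) 1 ⊆ V := by
      intro w hw
      have hw : ‖w‖ = 1 := by simpa using hw
      have hc : ContinuousAt (fun z => ((B.map fun a => z / (z - a)).sum).re) w :=
        Complex.continuous_re.continuousAt.comp
          (continuousAt_sum_div_sub B fun hz' => hB1 w hz' hw)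
      refine hc.tendsto.eventually_const_lt ?_
      rw [hon w hw]
      linarith
    obtain ⟨δ, hδ, hthick⟩ := (isCompact_sphere (0 : ℂ) 1).exists_thickening_subset_open hV hsub
    refine ⟨δ, hδ, fun w hw1 hw2 => ?_⟩
    have hw0 : (‖w‖ : ℂ) ≠ 0 := by exact_mod_cast (by linarith : ‖w‖ ≠ 0)
    have : w ∈ V := by
      refine hthick (Metric.mem_thickening_iff.2 ⟨w / ‖w‖, ?_, ?_⟩)
      · have : ‖w‖ ≠ 0 := by exact_mod_cast hw0
        simp [this]
      · have e : w - w / ‖w‖ = (w / ‖w‖) * ((‖w‖ - 1 : ℝ) : ℂ) := by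
          push_cast; field_simp
        have : ‖w‖ ≠ 0 := by exact_mod_cast hw0
        rw [dist_eq_norm, e, norm_mul, Complex.norm_real, norm_div, Complex.norm_real,
          norm_norm, div_self this, one_mul, Real.norm_of_nonneg (by linarith)]
        linarith
    exact this.self_of_nhds
  set r : ℝ := 1 + min δ₁ δ₂ / 2 with hr
  have hmin : 0 < min δ₁ δ₂ := lt_min hδ₁ hδ₂
  have hr1 : 1 < r := by linarith
  have hrδ₁ : r < 1 + δ₁ := by linarith [min_le_left δ₁ δ₂]
  have hrδ₂ : r < 1 + δ₂ := by linarith [min_le_right δ₁ δ₂]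
  have hiff : ∀ a ∈ U.roots + U.derivative.roots, (‖a‖ < r ↔ ‖a‖ ≤ 1) := by
    intro a ha
    refine ⟨fun har => ?_, fun ha1 => by linarith⟩
    by_contra hcon
    linarith [h1 a ha (not_le.1 hcon)]
  have hne : ∀ w : ℂ, ‖w‖ = r → U.eval w ≠ 0 := by
    intro w hw h0
    have := h1 w (Multiset.mem_add.2 (Or.inl ((mem_roots hU).2 h0))) (by linarith)
    linarith
  have c : (X * U.derivative).roots.countP (fun a => ‖a‖ < r) =
      U.roots.countP fun a => ‖a‖ < r := by
    refine countP_roots_eq_of_div_mem_slitPlane (by linarith) fun w hw => ?_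
    left
    have hwA : w ∉ A := fun hw' => by linarith [hA1 w hw']
    rw [eval_mul, eval_X, mul_eval_derivative_div_eval (hne w hw), ← hAB, Multiset.map_add,
      Multiset.sum_add, Complex.add_re]
    have e1 := re_sum_div_sub_ge A hA1 (by linarith : 1 ≤ ‖w‖) hwA
    have e2 := h2 w (by linarith) (by linarith)
    have e3 : (1 : ℝ) ≤ n := by exact_mod_cast hn
    linarith
  rw [countP_roots_X_mul_derivative hd _ (by simp; linarith)] at c
  have c1 : U.derivative.roots.countP (fun a => ‖a‖ < r) = n - 1 := by
    rw [← hcount]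
    classical
    exact Multiset.countP_congr rfl fun a ha =>
      propext (hiff a (Multiset.mem_add.2 (Or.inr ha)))
  have c2 : U.roots.countP (fun a => ‖a‖ < r) = U.roots.countP (fun a => ‖a‖ < 1) + A.card := by
    rw [← Multiset.countP_eq_card_filter]
    have e : U.roots.countP (fun a => ‖a‖ < r) = U.roots.countP fun a => ‖a‖ < 1 ∨ ‖a‖ = 1 :=
      Multiset.countP_congr rfl fun a ha => by
        rw [hiff a (Multiset.mem_add.2 (Or.inl ha)), le_iff_lt_or_eq]
    rw [e]
    simp only [Multiset.countP_eq_card_filter]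
    have := Multiset.filter_add_filter (fun a : ℂ => ‖a‖ < 1) (fun a : ℂ => ‖a‖ = 1) U.roots
    have hnone : U.roots.filter (fun a : ℂ => ‖a‖ < 1 ∧ ‖a‖ = 1) = 0 :=
      Multiset.filter_eq_nil.2 fun a _ ha => by linarith [ha.1, ha.2]
    rw [hnone, add_zero] at this
    rw [← this, Multiset.card_add]
  have hM : A.card = 0 := by
    rw [c1, c2] at c
    have e : ((U.roots.countP (fun a => ‖a‖ < 1) : ℕ) : ℝ) + A.card = n := by
      have : U.roots.countP (fun a => ‖a‖ < 1) + A.card = n := by omega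
      exact_mod_cast this
    rw [hN] at e
    have : (A.card : ℝ) = 0 := by linarith
    exact_mod_cast this
  intro hroot
  have : z ∈ A := Multiset.mem_filter.2 ⟨(mem_roots hU).2 hroot, hz⟩
  rw [Multiset.card_eq_zero.1 hM] at this
  exact Multiset.notMem_zero _ this

end IsRealOnCircle

/-! ### Zeros of polynomials in the closed class -/

theorem natDegree_le_of_degree_eq {n : ℕ} {F : ℂ[X]} (hF : F.degree = n) : F.natDegree ≤ n :=
  (natDegree_eq_of_degree_eq_some hF).le

theorem ne_zero_of_degree_eq_natCast {n : ℕ} {F : ℂ[X]} (hF : F.degree = n) : F ≠ 0 := by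
  rintro rfl
  simp at hF

theorem coeff_ne_zero_of_degree_eq {n : ℕ} {F : ℂ[X]} (hF : F.degree = n) : F.coeff n ≠ 0 :=
  coeff_ne_zero_of_eq_degree hF

theorem norm_le_one_of_mem_closedD {n : ℕ} {lam : ℝ} {F : ℂ[X]} (hF : F ∈ closedD n lam) {z : ℂ}
    (hz : F.IsRoot z) : ‖z‖ ≤ 1 := by
  by_contra hcon
  have h := hF.2 (Complex.exp (Complex.I * lam / 2) * z)
    (by rw [norm_mul, norm_exp_half, one_mul]; exact not_le.1 hcon)
  rw [imQuotient, eval_minusRot, ← mul_assoc, mul_comm (Complex.exp _) (Complex.exp _),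
    exp_half_mul_exp_neg_half, one_mul, hz.eq_zero] at h
  simp at h

theorem exp_mul_I_pow_ne_one {n : ℕ} {lam : ℝ} (hn : 1 ≤ n) (hlam0 : 0 < lam)
    (hlam1 : lam < 2 * Real.pi / n) {k : ℕ} (hk0 : 0 < k) (hkn : k ≤ n) :
    Complex.exp (Complex.I * lam) ^ k ≠ 1 := by
  rw [← Complex.exp_nat_mul]
  intro h
  obtain ⟨m, hm⟩ := Complex.exp_eq_one_iff.1 h
  have hm' : (k * lam : ℝ) = m * (2 * Real.pi) := by
    have : ((k * lam : ℝ) : ℂ) = ((m * (2 * Real.pi) : ℝ) : ℂ) := by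
      refine mul_left_cancel₀ Complex.I_ne_zero ?_
      push_cast
      linear_combination hm
    exact_mod_cast this
  have hpi := Real.pi_pos
  have hn' : (0 : ℝ) < n := by exact_mod_cast hn
  have hk : (0 : ℝ) < k := by exact_mod_cast hk0
  have hkn' : (k : ℝ) ≤ n := by exact_mod_cast hkn
  rw [lt_div_iff₀ hn'] at hlam1
  have h1 : (0 : ℝ) < m * (2 * Real.pi) := by rw [← hm']; positivity
  have h2 : (m : ℝ) * (2 * Real.pi) < 1 * (2 * Real.pi) := by rw [← hm']; nlinarith
  have h3 : (0 : ℝ) < m := pos_of_mul_pos_left h1 (by positivity)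
  have h4 : (m : ℝ) < 1 := lt_of_mul_lt_mul_right h2 (by positivity)
  have h5 : (0 : ℤ) < m := by exact_mod_cast h3
  have h6 : m < (1 : ℤ) := by exact_mod_cast h4
  omega

/-- If `F_+ (F^{*n})_- = F_- (F^{*n})_+`, the zeros of `F` in the open disk are invariant under the
rotation by `λ`. Such an orbit would have more than `n` points, or would be a zero at the origin of
an order `k ≤ n` with `e^{ikλ} = 1`. -/
theorem norm_eq_one_of_wronskian_eq_zero {n : ℕ} {lam : ℝ} (hn : 1 ≤ n) (hlam0 : 0 < lam)
    (hlam1 : lam < 2 * Real.pi / n) {F : ℂ[X]} (hF : F.degree = n)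
    (hroots : ∀ z, F.IsRoot z → ‖z‖ ≤ 1)
    (hT : plusRot lam F * minusRot lam (nInverse n F)
      - minusRot lam F * plusRot lam (nInverse n F) = 0) {z₀ : ℂ} (hz₀ : F.IsRoot z₀) :
    ‖z₀‖ = 1 := by
  have hF0 := ne_zero_of_degree_eq_natCast hF
  have hFn := natDegree_eq_of_degree_eq_some hF
  set G := nInverse n F with hG
  set h := Complex.exp (Complex.I * lam / 2) with hh
  set h' := Complex.exp (-(Complex.I * lam / 2)) with hh'
  have hhh : h * h' = 1 := exp_half_mul_exp_neg_half lam
  have hE : h * h = Complex.exp (Complex.I * lam) := by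
    rw [hh, ← Complex.exp_add]; congr 1; ring
  have hGne : ∀ z : ℂ, ‖z‖ < 1 → G.eval z ≠ 0 := by
    intro z hz
    by_cases h0 : z = 0
    · subst h0
      rw [hG, eval_zero_nInverse]
      simpa using coeff_ne_zero_of_degree_eq hF
    · rw [hG, eval_nInverse hFn.le h0]
      refine mul_ne_zero (pow_ne_zero _ h0) fun hc => ?_
      have := hroots _ ((map_eq_zero _).1 hc : F.IsRoot _)
      rw [norm_inv, RCLike.norm_conj] at this
      exact absurd ((inv_le_one₀ (norm_pos_iff.2 h0)).1 this) (not_le.2 hz)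
  have hT' : ∀ z, F.eval (h * z) * G.eval (h' * z) = F.eval (h' * z) * G.eval (h * z) := by
    intro z
    have := congrArg (eval z) hT
    rw [eval_sub, eval_mul, eval_mul, eval_plusRot, eval_plusRot, eval_minusRot, eval_minusRot,
      eval_zero, sub_eq_zero] at this
    exact this
  by_contra hne
  have hlt : ‖z₀‖ < 1 := lt_of_le_of_ne (hroots _ hz₀) hne
  by_cases h0 : z₀ = 0
  · subst h0
    obtain ⟨H, hH, hH0⟩ := exists_eq_pow_rootMultiplicity_mul_and_not_dvd F hF0 0
    set k := F.rootMultiplicity 0 with hk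
    have hkpos : 0 < k := (rootMultiplicity_pos hF0).2 hz₀
    have hkn : k ≤ n := by
      rw [← hFn, hk, ← count_roots]
      exact (Multiset.count_le_card _ _).trans (card_roots' F)
    rw [dvd_iff_isRoot] at hH0
    rw [C_0, sub_zero] at hH
    have hFH : ∀ z, F.eval z = z ^ k * H.eval z := fun z => by
      conv_lhs => rw [hH]
      simp
    have key : X ^ k * (C (h ^ k) * plusRot lam H * minusRot lam G -
        C (h' ^ k) * minusRot lam H * plusRot lam G) = 0 := by
      refine Polynomial.funext fun z => ?_
      have := hT' z
      rw [hFH, hFH, mul_pow, mul_pow] at this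
      simp only [eval_mul, eval_sub, eval_pow, eval_X, eval_C, eval_plusRot, eval_minusRot,
        eval_zero]
      linear_combination this
    have key2 := (mul_eq_zero.1 key).resolve_left (pow_ne_zero _ X_ne_zero)
    have key3 := congrArg (eval 0) key2
    simp only [eval_mul, eval_sub, eval_C, eval_plusRot, eval_minusRot, eval_zero, mul_zero]
      at key3
    have hne2 : H.eval 0 * G.eval 0 ≠ 0 := mul_ne_zero hH0 (hGne 0 (by simp))
    have : (h ^ k - h' ^ k) * (H.eval 0 * G.eval 0) = 0 := by linear_combination key3
    have h1 := sub_eq_zero.1 ((mul_eq_zero.1 this).resolve_right hne2)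
    refine exp_mul_I_pow_ne_one hn hlam0 hlam1 hkpos hkn ?_
    rw [← hE, mul_pow]
    nth_rw 2 [h1]
    rw [← mul_pow, hhh, one_pow]
  · set E := Complex.exp (Complex.I * lam) with hEdef
    have hEn : ‖E‖ = 1 := by rw [hEdef, mul_comm, Complex.norm_exp_ofReal_mul_I]
    have horbit : ∀ k : ℕ, F.IsRoot (E ^ k * z₀) := by
      intro k
      induction k with
      | zero => simpa using hz₀
      | succ k ih =>
        have := hT' (h * (E ^ k * z₀))
        rw [← mul_assoc h, ← mul_assoc h', hE, mul_comm h' h, hhh, one_mul, ih.eq_zero,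
          zero_mul] at this
        have h2 := (mul_eq_zero.1 this).resolve_right (hGne _ (by
          rw [norm_mul, norm_pow, hEn, one_pow, one_mul]; exact hlt))
        rw [IsRoot.def, pow_succ, mul_comm (E ^ k) E, mul_assoc]
        exact h2
    have hinj : Set.InjOn (fun k : ℕ => E ^ k * z₀) (Finset.range (n + 1)) := by
      have aux : ∀ i j : ℕ, i < j → j ≤ n → E ^ i * z₀ ≠ E ^ j * z₀ := by
        intro i j hij hj he
        have h1 := mul_right_cancel₀ h0 he
        refine exp_mul_I_pow_ne_one hn hlam0 hlam1 (Nat.sub_pos_of_lt hij)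
          ((Nat.sub_le j i).trans hj) ?_
        have hEi : E ^ i ≠ 0 := pow_ne_zero _ (Complex.exp_ne_zero _)
        refine mul_left_cancel₀ hEi ?_
        rw [← pow_add, Nat.add_sub_cancel' hij.le, mul_one, h1]
      intro i hi j hj he
      have hi' : i ≤ n := by simpa [Nat.lt_succ_iff] using hi
      have hj' : j ≤ n := by simpa [Nat.lt_succ_iff] using hj
      rcases lt_trichotomy i j with hlt | heq | hgt
      · exact absurd he (aux i j hlt hj')
      · exact heq
      · exact absurd he.symm (aux j i hgt hi')
    have hcard := Finset.card_image_of_injOn hinj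
    have hsub : ((Finset.range (n + 1)).image fun k : ℕ => E ^ k * z₀).val ⊆ F.roots := by
      intro x hx
      rw [Finset.mem_val] at hx
      obtain ⟨k, -, rfl⟩ := Finset.mem_image.1 hx
      exact (mem_roots hF0).2 (horbit k)
    have := card_le_degree_of_subset_roots hsub
    rw [hcard, hFn, Finset.card_range] at this
    omega

/-- The Möbius factor `(1 - e v) / (e - v)`, `e = e^{-iλ/2}`, that a zero `a` of `F` contributes
to `e^{-inλ/2} F_+(z) / F_-(z)`, with `v = a / z`. -/
noncomputable def moebiusFactor (lam : ℝ) (v : ℂ) : ℂ :=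
  (1 - Complex.exp (-(Complex.I * lam / 2)) * v) / (Complex.exp (-(Complex.I * lam / 2)) - v)

theorem exp_neg_half_eq (lam : ℝ) : Complex.exp (-(Complex.I * lam / 2)) =
    ⟨Real.cos (lam / 2), -Real.sin (lam / 2)⟩ := by
  have : -(Complex.I * lam / 2) = ((-(lam / 2) : ℝ) : ℂ) * Complex.I := by push_cast; ring
  rw [this]
  apply Complex.ext
  · rw [Complex.exp_ofReal_mul_I_re, Real.cos_neg]
  · rw [Complex.exp_ofReal_mul_I_im, Real.sin_neg]

theorem exp_neg_half_sub_ne_zero (lam : ℝ) {v : ℂ} (hv : ‖v‖ < 1) :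
    Complex.exp (-(Complex.I * lam / 2)) - v ≠ 0 := by
  intro h0
  rw [← sub_eq_zero.1 h0, norm_exp_neg_half] at hv
  exact lt_irrefl _ hv

theorem moebiusFactor_im (lam : ℝ) (v : ℂ) : (moebiusFactor lam v).im =
    Real.sin (lam / 2) * (1 - ‖v‖ ^ 2) /
      Complex.normSq (Complex.exp (-(Complex.I * lam / 2)) - v) := by
  rw [moebiusFactor, Complex.div_im, ← sub_div, ← Complex.normSq_eq_norm_sq, exp_neg_half_eq]
  congr 1
  simp [Complex.normSq_apply]
  linear_combination (-v.im) * Real.sin_sq_add_cos_sq (lam / 2)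

theorem moebiusFactor_re (lam : ℝ) (v : ℂ) : (moebiusFactor lam v).re =
    (Real.cos (lam / 2) * (1 + ‖v‖ ^ 2) - 2 * v.re) /
      Complex.normSq (Complex.exp (-(Complex.I * lam / 2)) - v) := by
  rw [moebiusFactor, Complex.div_re, ← add_div, ← Complex.normSq_eq_norm_sq, exp_neg_half_eq]
  congr 1
  simp [Complex.normSq_apply]
  linear_combination (-v.re) * Real.sin_sq_add_cos_sq (lam / 2)

theorem moebiusFactor_im_pos {lam : ℝ} (h : 0 < Real.sin (lam / 2)) {v : ℂ} (hv : ‖v‖ < 1) :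
    0 < (moebiusFactor lam v).im := by
  rw [moebiusFactor_im]
  have h1 := exp_neg_half_sub_ne_zero lam hv
  have h2 : 0 < 1 - ‖v‖ ^ 2 := by nlinarith [norm_nonneg v]
  exact div_pos (mul_pos h h2) (Complex.normSq_pos.2 h1)

theorem multiset_prod_eq_norm_mul_exp_arg (s : Multiset ℂ) :
    s.prod = ‖s.prod‖ * Complex.exp ((s.map Complex.arg).sum * Complex.I) := by
  induction s using Multiset.induction_on with
  | empty => simp
  | cons a s ih =>
    rw [Multiset.prod_cons, Multiset.map_cons, Multiset.sum_cons, norm_mul]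
    nth_rw 1 [ih]
    nth_rw 1 [← Complex.norm_mul_exp_arg_mul_I a]
    push_cast
    rw [add_mul, Complex.exp_add]
    ring

/-- The quotient defining the classes as a product of Möbius factors. -/
theorem exp_mul_div_eq_prod_moebiusFactor {n : ℕ} {F : ℂ[X]} (hF : F.degree = n) (lam : ℝ) {y : ℂ}
    (hy : y ≠ 0) : Complex.exp (-(Complex.I * n * lam / 2)) *
      ((plusRot lam F).eval y / (minusRot lam F).eval y) =
      (F.roots.map fun a => moebiusFactor lam (a / y)).prod := by
  have hcard : F.roots.card = n := by
    rw [← (IsAlgClosed.splits F).natDegree_eq_card_roots, natDegree_eq_of_degree_eq_some hF]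
  have hl : F.leadingCoeff ≠ 0 := leadingCoeff_ne_zero.2 (ne_zero_of_degree_eq_natCast hF)
  rw [eval_plusRot, eval_minusRot, (IsAlgClosed.splits F).eval_eq_prod_roots,
    (IsAlgClosed.splits F).eval_eq_prod_roots, mul_div_mul_left _ _ hl, ← Multiset.prod_map_div,
    exp_neg_nat_half]
  conv_lhs => rw [← hcard, ← Multiset.prod_replicate, ← Multiset.map_const',
    ← Multiset.prod_map_mul]
  refine congrArg Multiset.prod (Multiset.map_congr rfl fun a _ => ?_)
  have hhh := exp_half_mul_exp_neg_half lam
  rw [moebiusFactor, ← mul_div_mul_right (1 - _) _ hy]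
  have e1 : (1 - Complex.exp (-(Complex.I * lam / 2)) * (a / y)) * y =
      Complex.exp (-(Complex.I * lam / 2)) * (Complex.exp (Complex.I * lam / 2) * y - a) := by
    field_simp
    linear_combination (-y) * hhh
  have e2 : (Complex.exp (-(Complex.I * lam / 2)) - a / y) * y =
      Complex.exp (-(Complex.I * lam / 2)) * y - a := by
    field_simp
  rw [e1, e2]
  exact (mul_div_assoc _ _ _).symm

/-- The sum of the arguments of the Möbius factors is `nλ/2 < π` at infinity. If two zeros were at
an angle below `λ`, then along the ray towards a point between them two of the arguments, which are
all nonnegative, would exceed `π / 2`, and the sum would take the value `π` on the way. -/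
theorem le_abs_arg_of_mem_closedD {n : ℕ} {lam : ℝ} (hn : 1 ≤ n) (hlam0 : 0 < lam)
    (hlam1 : lam < 2 * Real.pi / n) {F : ℂ[X]} (hF : F ∈ closedD n lam)
    (hroots : ∀ z, F.IsRoot z → ‖z‖ = 1) {z w : ℂ} (hzw : ({z, w} : Multiset ℂ) ≤ F.roots) :
    lam ≤ |Complex.arg (z / w)| := by
  by_contra hcon
  rw [not_le] at hcon
  have hpi := Real.pi_pos
  have hn' : (1 : ℝ) ≤ n := by exact_mod_cast hn
  have hnlam : n * (lam / 2) < Real.pi := by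
    rw [lt_div_iff₀ (by linarith)] at hlam1
    linarith
  have hlampi : lam / 2 < Real.pi := by nlinarith
  have hsin : 0 < Real.sin (lam / 2) := Real.sin_pos_of_pos_of_lt_pi (by linarith) hlampi
  have hcard : F.roots.card = n := by
    rw [← (IsAlgClosed.splits F).natDegree_eq_card_roots, natDegree_eq_of_degree_eq_some hF.1]
  have hmem : ∀ a ∈ F.roots, ‖a‖ = 1 := fun a ha => hroots a (isRoot_of_mem_roots ha)
  have hz1 : ‖z‖ = 1 := hmem z (Multiset.mem_of_le hzw (by simp))
  have hw1 : ‖w‖ = 1 := hmem w (Multiset.mem_of_le hzw (by simp))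
  have hw0 : w ≠ 0 := by rintro rfl; simp at hw1
  obtain ⟨s, hs⟩ := Multiset.le_iff_exists_add.1 hzw
  -- the point half-way between `w` and `z`
  set d := Complex.arg (z / w) with hd
  set m := Complex.exp ((d / 2 : ℝ) * Complex.I) with hm
  have hm1 : ‖m‖ = 1 := Complex.norm_exp_ofReal_mul_I _
  have hm0 : m ≠ 0 := Complex.exp_ne_zero _
  have hzm : z = w * m * m := by
    have h1 := Complex.norm_mul_exp_arg_mul_I (z / w)
    rw [norm_div, hz1, hw1, div_one, Complex.ofReal_one, one_mul, ← hd] at h1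
    have h2 : m * m = Complex.exp (d * Complex.I) := by
      rw [hm, ← Complex.exp_add]; congr 1; push_cast; ring
    rw [mul_assoc, h2, h1]
    field_simp
  set u := w * m with hu
  have hu1 : ‖u‖ = 1 := by rw [hu, norm_mul, hw1, hm1, one_mul]
  have hu0 : u ≠ 0 := mul_ne_zero hw0 hm0
  have hre : Real.cos (lam / 2) < m.re := by
    rw [hm, Complex.exp_ofReal_mul_I_re, ← Real.cos_abs (d / 2), abs_div, abs_two]
    exact Real.cos_lt_cos_of_nonneg_of_le_pi (by positivity) hlampi.le (by linarith)
  have hzu : z / u = m := by rw [hzm]; field_simp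
  have hwu : w / u = starRingEnd ℂ m := by
    rw [← Complex.inv_eq_conj hm1, hu]; field_simp
  -- the sum of the arguments of the factors along the ray, `x` being the reciprocal radius
  let v : ℂ → ℝ → ℂ := fun a x => a / u * x
  have hv : ∀ a ∈ F.roots, ∀ x : ℝ, 0 ≤ x → x < 1 → ‖v a x‖ < 1 := by
    intro a ha x hx0 hx1
    rw [norm_mul, norm_div, hmem a ha, hu1, div_one, one_mul, Complex.norm_real,
      Real.norm_of_nonneg hx0]
    exact hx1
  let θ : ℝ → ℝ := fun x => (F.roots.map fun a => Complex.arg (moebiusFactor lam (v a x))).sum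
  have hθcont : ContinuousOn θ (Set.Ico 0 1) := by
    have : ∀ t : Multiset ℂ, t ≤ F.roots → ContinuousOn (fun x : ℝ =>
        (t.map fun a => Complex.arg (moebiusFactor lam (v a x))).sum) (Set.Ico 0 1) := by
      intro t
      induction t using Multiset.induction_on with
      | empty => intro _; simpa using continuousOn_const
      | cons a t ih =>
        intro ht
        simp only [Multiset.map_cons, Multiset.sum_cons]
        refine ContinuousOn.add ?_ (ih ((Multiset.le_cons_self t a).trans ht))
        intro x hx
        have hvx := hv a (Multiset.mem_of_le ht (Multiset.mem_cons_self a t)) x hx.1 hx.2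
        have hc : ContinuousAt (fun x : ℝ => moebiusFactor lam (v a x)) x := by
          unfold moebiusFactor
          exact ContinuousAt.div (by fun_prop) (by fun_prop) (exp_neg_half_sub_ne_zero lam hvx)
        exact (ContinuousAt.comp (f := fun x : ℝ => moebiusFactor lam (v a x))
          (Complex.continuousAt_arg (Or.inr (moebiusFactor_im_pos hsin hvx).ne'))
          hc).continuousWithinAt
    exact this _ le_rfl
  have hθ0 : θ 0 = n * (lam / 2) := by
    have : ∀ a, Complex.arg (moebiusFactor lam (v a 0)) = lam / 2 := by
      intro a
      have e : moebiusFactor lam (v a 0) = Complex.exp ((lam / 2 : ℝ) * Complex.I) := by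
        simp only [moebiusFactor, v, Complex.ofReal_zero, mul_zero, sub_zero]
        rw [one_div, ← Complex.exp_neg]; congr 1; push_cast; ring
      rw [e, Complex.arg_exp_mul_I, toIocMod_eq_self]
      exact ⟨by linarith, by linarith⟩
    simp only [θ, this]
    rw [Multiset.map_const', Multiset.sum_replicate, hcard, nsmul_eq_mul]
  obtain ⟨x₁, hx₁0, hx₁1, hx₁⟩ : ∃ x : ℝ, 0 < x ∧ x < 1 ∧
      Real.cos (lam / 2) * (1 + x ^ 2) - 2 * (x * m.re) < 0 := by
    have hc : ContinuousAt (fun x : ℝ => Real.cos (lam / 2) * (1 + x ^ 2) - 2 * (x * m.re)) 1 := by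
      fun_prop
    have h1 := (hc.tendsto.mono_left (nhdsWithin_le_nhds (s := Set.Iio 1))).eventually_lt_const
      (u := 0) (by linarith)
    obtain ⟨x, hx, hx'⟩ := (h1.and (Ioo_mem_nhdsLT (zero_lt_one' ℝ))).exists
    exact ⟨x, hx'.1, hx'.2, hx⟩
  have harg : ∀ a ∈ F.roots, (a / u).re = m.re →
      Real.pi / 2 < Complex.arg (moebiusFactor lam (v a x₁)) := by
    intro a ha hare
    have hva := hv a ha x₁ hx₁0.le hx₁1
    have him := moebiusFactor_im_pos hsin hva
    have hneg : (moebiusFactor lam (v a x₁)).re < 0 := by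
      rw [moebiusFactor_re]
      refine div_neg_of_neg_of_pos ?_ (Complex.normSq_pos.2 (exp_neg_half_sub_ne_zero lam hva))
      have e1 : ‖v a x₁‖ = x₁ := by
        rw [norm_mul, norm_div, hmem a ha, hu1, div_one, one_mul, Complex.norm_real,
          Real.norm_of_nonneg hx₁0.le]
      have e2 : (v a x₁).re = x₁ * m.re := by
        simp only [v]
        rw [Complex.re_mul_ofReal, hare, mul_comm]
      rw [e1, e2]
      exact hx₁
    by_contra hle
    have h0 : 0 ≤ Complex.arg (moebiusFactor lam (v a x₁)) := Complex.arg_nonneg_iff.2 him.le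
    have := Complex.abs_arg_le_pi_div_two_iff.1 (by rw [abs_of_nonneg h0]; exact not_lt.1 hle)
    linarith
  have hθ1 : Real.pi ≤ θ x₁ := by
    have ez : (z / u).re = m.re := by rw [hzu]
    have ew : (w / u).re = m.re := by rw [hwu, Complex.conj_re]
    have az := harg z (Multiset.mem_of_le hzw (by simp)) ez
    have aw := harg w (Multiset.mem_of_le hzw (by simp)) ew
    have hsnn : 0 ≤ (s.map fun a => Complex.arg (moebiusFactor lam (v a x₁))).sum := by
      refine Multiset.sum_nonneg fun y hy => ?_
      obtain ⟨a, ha, rfl⟩ := Multiset.mem_map.1 hy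
      have ha' : a ∈ F.roots := by rw [hs]; exact Multiset.mem_add.2 (Or.inr ha)
      exact Complex.arg_nonneg_iff.2 (moebiusFactor_im_pos hsin (hv a ha' x₁ hx₁0.le hx₁1)).le
    simp only [θ]
    rw [hs, Multiset.map_add, Multiset.sum_add]
    simp only [Multiset.insert_eq_cons, Multiset.map_cons, Multiset.map_singleton,
      Multiset.sum_cons, Multiset.sum_singleton]
    linarith
  obtain ⟨x₀, hx₀, hθx₀⟩ := intermediate_value_Icc hx₁0.le
    (hθcont.mono fun x hx => ⟨hx.1, hx.2.trans_lt hx₁1⟩)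
    (show Real.pi ∈ Set.Icc (θ 0) (θ x₁) from ⟨by rw [hθ0]; exact hnlam.le, hθ1⟩)
  have hx₀pos : 0 < x₀ := by
    refine lt_of_le_of_ne hx₀.1 ?_
    rintro rfl
    rw [hθ0] at hθx₀
    linarith
  have hx₀lt : x₀ < 1 := hx₀.2.trans_lt hx₁1
  have hx₀c : (x₀ : ℂ) ≠ 0 := by exact_mod_cast hx₀pos.ne'
  have hpos := hF.2 (u / x₀) (by
    rw [norm_div, hu1, Complex.norm_real, Real.norm_of_nonneg hx₀pos.le]
    exact (one_lt_div hx₀pos).2 hx₀lt)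
  rw [imQuotient, exp_mul_div_eq_prod_moebiusFactor hF.1 lam (div_ne_zero hu0 hx₀c)] at hpos
  have e : (F.roots.map fun a => moebiusFactor lam (a / (u / x₀))) =
      F.roots.map fun a => moebiusFactor lam (v a x₀) := by
    refine Multiset.map_congr rfl fun a _ => ?_
    simp only [v]
    congr 1
    field_simp
  rw [e, multiset_prod_eq_norm_mul_exp_arg, Multiset.map_map] at hpos
  have e2 : (F.roots.map (Complex.arg ∘ fun a => moebiusFactor lam (v a x₀))).sum = Real.pi :=
    hθx₀
  rw [e2, Complex.exp_pi_mul_I] at hpos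
  simp at hpos

/-! ### The maximum principle outside the unit disk -/

/-- The quotient `e^{-inλ/2} G_+ / G_-` for the `n`-inverse `G` of `F`. Under the reflection
`z ↦ 1 / conj z` it is the complex conjugate of the quotient for `F`, and it is regular at the
origin, which corresponds to infinity. -/
noncomputable def reflectedQuotient (n : ℕ) (lam : ℝ) (F : ℂ[X]) (z : ℂ) : ℂ :=
  Complex.exp (-(Complex.I * n * lam / 2)) *
    ((plusRot lam (nInverse n F)).eval z / (minusRot lam (nInverse n F)).eval z)

theorem imQuotient_eq_neg_im_reflectedQuotient {n : ℕ} {F : ℂ[X]} (hF : F.natDegree ≤ n)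
    (lam : ℝ) {z : ℂ} (hz : z ≠ 0) :
    imQuotient n lam F z = -(reflectedQuotient n lam F (starRingEnd ℂ z)⁻¹).im := by
  have hz' : (starRingEnd ℂ z)⁻¹ ≠ 0 := inv_ne_zero ((_root_.map_ne_zero (starRingEnd ℂ)).2 hz)
  have hhh := exp_half_mul_exp_neg_half lam
  set h := Complex.exp (Complex.I * lam / 2) with hh
  set h' := Complex.exp (-(Complex.I * lam / 2)) with hh'
  have h0 : h ≠ 0 := Complex.exp_ne_zero _
  have h0' : h' ≠ 0 := Complex.exp_ne_zero _
  have hinv : h⁻¹ = h' := inv_eq_of_mul_eq_one_right hhh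
  have hinv' : h'⁻¹ = h := inv_eq_of_mul_eq_one_left hhh
  have e : reflectedQuotient n lam F (starRingEnd ℂ z)⁻¹ =
      starRingEnd ℂ (Complex.exp (-(Complex.I * n * lam / 2)) *
        ((plusRot lam F).eval z / (minusRot lam F).eval z)) := by
    rw [reflectedQuotient, eval_plusRot, eval_minusRot, eval_plusRot, eval_minusRot, ← hh, ← hh',
      eval_nInverse hF (mul_ne_zero h0 hz'), eval_nInverse hF (mul_ne_zero h0' hz'),
      exp_neg_nat_half, ← hh']
    simp only [map_mul, map_div₀, map_pow, map_inv₀, mul_inv, inv_inv, Complex.conj_conj]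
    rw [hh, hh', conj_exp_half, conj_exp_neg_half, ← hh, ← hh', hinv, hinv', mul_pow, mul_pow,
      mul_div_mul_comm, mul_div_mul_comm]
    rw [div_self (pow_ne_zero n (inv_ne_zero ((_root_.map_ne_zero (starRingEnd ℂ)).2 hz))), mul_one,
      ← mul_assoc, mul_div_cancel₀ _ (pow_ne_zero n h0')]
  rw [e, Complex.conj_im, neg_neg, imQuotient]

/-- If `Im (e^{-inλ/2} F_+ / F_-)` has a constant sign on the circle and the zeros of `F` lie in
the open disk, this sign is the one at infinity, where the value is `sin (nλ/2) > 0`; and by the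
maximum principle for `exp (± i f)` the imaginary part is positive outside the disk. -/
theorem imQuotient_pos_of_sign {n : ℕ} {lam : ℝ} (hn : 1 ≤ n) (hlam0 : 0 < lam)
    (hlam1 : lam < 2 * Real.pi / n) {F : ℂ[X]} (hF : F ∈ polysWithZerosIn n openDisk)
    (hsign : (∀ z : ℂ, ‖z‖ = 1 → 0 ≤ imProduct n lam F z) ∨
      ∀ z : ℂ, ‖z‖ = 1 → imProduct n lam F z ≤ 0) :
    (∀ z : ℂ, ‖z‖ = 1 → 0 ≤ imProduct n lam F z) ∧
      ∀ z : ℂ, 1 < ‖z‖ → 0 < imQuotient n lam F z := by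
  have hFn := natDegree_le_of_degree_eq hF.1
  have hn' : (1 : ℝ) ≤ n := by exact_mod_cast hn
  have hsin : 0 < Real.sin (n * (lam / 2)) := by
    rw [lt_div_iff₀ (by linarith)] at hlam1
    exact Real.sin_pos_of_pos_of_lt_pi (by positivity) (by linarith)
  set G := nInverse n F with hG
  have hG0 : G.eval 0 ≠ 0 := by
    rw [hG, eval_zero_nInverse]
    simpa using coeff_ne_zero_of_degree_eq hF.1
  have hGne : ∀ z : ℂ, ‖z‖ ≤ 1 → G.eval z ≠ 0 := by
    intro z hz
    by_cases h0 : z = 0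
    · rw [h0]; exact hG0
    · rw [hG, eval_nInverse hFn h0]
      refine mul_ne_zero (pow_ne_zero _ h0) fun hc => ?_
      have : ‖(starRingEnd ℂ z)⁻¹‖ < 1 := hF.2 _ ((map_eq_zero _).1 hc)
      rw [norm_inv, RCLike.norm_conj] at this
      exact absurd this (not_lt.2 ((one_le_inv₀ (norm_pos_iff.2 h0)).2 hz))
  set g := reflectedQuotient n lam F with hg
  have hgd : DifferentiableOn ℂ g (Metric.closedBall 0 1) := by
    intro z hz
    have hz : ‖z‖ ≤ 1 := by simpa using hz
    have hne : (minusRot lam G).eval z ≠ 0 := by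
      rw [eval_minusRot]
      exact hGne _ (by rw [norm_mul, norm_exp_neg_half, one_mul]; exact hz)
    have hq := (plusRot lam G).differentiableAt.div (minusRot lam G).differentiableAt hne
    exact (hq.const_mul _).differentiableWithinAt
  have hg0 : (g 0).im = -Real.sin (n * (lam / 2)) := by
    have e1 : g 0 = Complex.exp ((-(n * (lam / 2)) : ℝ) * Complex.I) := by
      simp only [hg, reflectedQuotient, eval_plusRot, eval_minusRot, mul_zero]
      rw [div_self hG0, mul_one]
      congr 1; push_cast; ring
    rw [e1, Complex.exp_ofReal_mul_I_im, Real.sin_neg]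
  have hcircle : ∀ z : ℂ, ‖z‖ = 1 →
      (g z).im = -(imProduct n lam F z / Complex.normSq ((minusRot lam F).eval z)) := by
    intro z hz
    have h0 : z ≠ 0 := by rintro rfl; simp at hz
    have := imQuotient_eq_neg_im_reflectedQuotient hFn lam h0
    rw [← map_inv₀, Complex.inv_eq_conj hz, Complex.conj_conj, imQuotient_eq_div] at this
    rw [this, neg_neg]
  have hexp : ∀ (c : ℝ) (z : ℂ), ‖Complex.exp (c * Complex.I * g z)‖ = Real.exp (-c * (g z).im) := by
    intro c z
    rw [Complex.norm_exp, mul_assoc, Complex.re_ofReal_mul, Complex.I_mul_re]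
    congr 1; ring
  have hdiff : ∀ c : ℝ, DiffContOnCl ℂ (fun z => Complex.exp (c * Complex.I * g z))
      (Metric.ball 0 1) := by
    intro c
    refine DifferentiableOn.diffContOnCl ?_
    rw [closure_ball _ one_ne_zero]
    exact (hgd.const_mul _).cexp
  have hmax : ∀ c : ℝ, (∀ z : ℂ, ‖z‖ = 1 → 0 ≤ c * (g z).im) →
      ∀ z : ℂ, ‖z‖ < 1 → ‖Complex.exp (c * Complex.I * g z)‖ ≤ 1 := by
    intro c hc z hz
    refine Complex.norm_le_of_forall_mem_frontier_norm_le Metric.isBounded_ball (hdiff c)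
      (fun y hy => ?_) (subset_closure (by simpa using hz))
    rw [frontier_ball _ one_ne_zero] at hy
    rw [hexp, Real.exp_le_one_iff]
    linarith [hc y (by simpa using hy)]
  have hnonneg : ∀ z : ℂ, ‖z‖ = 1 → 0 ≤ imProduct n lam F z := by
    refine hsign.resolve_right fun hneg => ?_
    have := hmax 1 (fun z hz => by
      rw [hcircle z hz, one_mul, neg_nonneg]
      exact div_nonpos_of_nonpos_of_nonneg (hneg z hz) (Complex.normSq_nonneg _)) 0 (by simp)
    rw [hexp, Real.exp_le_one_iff, hg0] at this
    linarith
  have hle := hmax (-1) fun z hz => by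
    rw [hcircle z hz, neg_mul_neg, one_mul]
    exact div_nonneg (hnonneg z hz) (Complex.normSq_nonneg _)
  have hlt : ∀ y : ℂ, ‖y‖ < 1 → (g y).im < 0 := by
    intro y hy
    have h1 := hle y hy
    rw [hexp, Real.exp_le_one_iff] at h1
    refine lt_of_le_of_ne (by linarith) fun h0 => ?_
    have hy' : y ∈ Metric.ball (0 : ℂ) 1 := by simpa using hy
    have hm : IsMaxOn (norm ∘ fun z => Complex.exp ((-1 : ℝ) * Complex.I * g z))
        (Metric.ball 0 1) y := by
      intro z hz
      have e : ‖Complex.exp ((-1 : ℝ) * Complex.I * g y)‖ = 1 := by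
        rw [hexp, h0, mul_zero, Real.exp_zero]
      exact (hle z (by simpa using hz)).trans e.ge
    have heq := Complex.norm_eqOn_of_isPreconnected_of_isMaxOn
      (convex_ball (0 : ℂ) 1).isPreconnected Metric.isOpen_ball (hdiff (-1)).differentiableOn hy' hm
      (Metric.mem_ball_self one_pos)
    simp only [Function.comp_apply, Function.const_apply] at heq
    rw [hexp, hexp, h0, mul_zero, Real.exp_zero, Real.exp_eq_one_iff, hg0] at heq
    linarith
  refine ⟨hnonneg, fun z hz => ?_⟩
  have h0 : z ≠ 0 := by rintro rfl; simp at hz; linarith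
  rw [imQuotient_eq_neg_im_reflectedQuotient hFn lam h0, neg_pos]
  refine hlt _ ?_
  rw [norm_inv, RCLike.norm_conj]
  exact inv_lt_one_of_one_lt₀ hz

/-! ### The two circle polynomials of `P - Q` -/

theorem nInverse_eq_of_isSelfInversiveConst {n : ℕ} {P : ℂ[X]} {c : ℂ}
    (hc : IsSelfInversiveConst n P c) : nInverse n P = C (c ^ 2) * P := by
  obtain ⟨⟨t, -, -, ht⟩, h⟩ := hc
  have hnorm : ‖c‖ = 1 := by rw [ht, mul_comm, Complex.norm_exp_ofReal_mul_I]
  have hcc : c * starRingEnd ℂ c = 1 := by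
    rw [Complex.mul_conj, Complex.normSq_eq_norm_sq, hnorm]; simp
  rw [nInverse_C_mul] at h
  have : C c * (C (starRingEnd ℂ c) * nInverse n P) = C c * (C c * P) := by rw [h]
  rw [← mul_assoc, ← mul_assoc, ← C_mul, ← C_mul, hcc, C_1, one_mul] at this
  rw [this, sq]

theorem sq_ne_sq_of_isSelfInversiveConst {n : ℕ} {P Q : ℂ[X]} {a b : ℂ}
    (ha : IsSelfInversiveConst n P a) (hb : IsSelfInversiveConst n Q b) (hab : a ≠ b) :
    a ^ 2 ≠ b ^ 2 := by
  obtain ⟨⟨t, ht0, ht1, rfl⟩, -⟩ := ha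
  obtain ⟨⟨s, hs0, hs1, rfl⟩, -⟩ := hb
  intro hsq
  rcases sq_eq_sq_iff_eq_or_eq_neg.1 hsq with h | h
  · exact hab h
  · have him := congrArg Complex.im h
    rw [mul_comm, mul_comm Complex.I, Complex.neg_im, Complex.exp_ofReal_mul_I_im,
      Complex.exp_ofReal_mul_I_im] at him
    have h1 := Real.sin_nonneg_of_nonneg_of_le_pi ht0 ht1.le
    have h2 := Real.sin_nonneg_of_nonneg_of_le_pi hs0 hs1.le
    have f1 := (Real.sin_eq_zero_iff_of_lt_of_lt (by linarith [Real.pi_pos]) ht1).1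
      (by linarith)
    have f2 := (Real.sin_eq_zero_iff_of_lt_of_lt (by linarith [Real.pi_pos]) hs1).1
      (by linarith)
    exact hab (by rw [f1, f2])

/-- The form `(A, B) ↦ A_+ B_- - A_- B_+` is bilinear and alternating, so that the polynomials
formed from `P - Q` and its `n`-inverse `c_P² P - c_Q² Q` and from `P` and `Q` are proportional. -/
theorem wronskian_eq_C_mul {n : ℕ} {P Q : ℂ[X]} {a b : ℂ} (ha : IsSelfInversiveConst n P a)
    (hb : IsSelfInversiveConst n Q b) (lam : ℝ) :
    plusRot lam (P - Q) * minusRot lam (nInverse n (P - Q))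
      - minusRot lam (P - Q) * plusRot lam (nInverse n (P - Q)) =
    C (a ^ 2 - b ^ 2) *
      (plusRot lam P * minusRot lam Q - minusRot lam P * plusRot lam Q) := by
  rw [nInverse_sub, nInverse_eq_of_isSelfInversiveConst ha, nInverse_eq_of_isSelfInversiveConst hb]
  simp only [plusRot_sub, minusRot_sub, plusRot_C_mul, minusRot_C_mul, C_sub]
  ring

/-! ### Membership in the classes -/

theorem not_mem_polysWithZerosIn_unitCircle {n : ℕ} (hn : 1 ≤ n) {F : ℂ[X]}
    (hF : F ∈ polysWithZerosIn n openDisk) : F ∉ polysWithZerosIn n unitCircle := by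
  intro h
  obtain ⟨z, hz⟩ := Complex.exists_root (f := F) (by rw [hF.1]; exact_mod_cast hn)
  have h1 : ‖z‖ < 1 := hF.2 z hz
  have h2 : ‖z‖ = 1 := h.2 z hz
  linarith

theorem mem_closedD_of_circleZerosEven {n : ℕ} {lam : ℝ} (hn : 1 ≤ n) (hlam0 : 0 < lam)
    (hlam1 : lam < 2 * Real.pi / n) {F U : ℂ[X]} {κ : ℂ}
    (hU : IsRealOnCircle n κ (fun t => imProduct n lam F (Complex.exp (t * Complex.I))) U)
    (hF : F ∈ polysWithZerosIn n openDisk) (heven : CircleZerosEven U) :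
    (∀ z : ℂ, ‖z‖ = 1 → 0 ≤ imProduct n lam F z) ∧ F ∈ closedD n lam \ closedT n lam := by
  have h := imQuotient_pos_of_sign hn hlam0 hlam1 hF <| by
    rcases hU.nonneg_or_nonpos_of_circleZerosEven heven with h | h
    · left
      intro z hz
      obtain ⟨t, rfl⟩ := exists_eq_exp_of_norm_eq_one hz
      exact h t
    · right
      intro z hz
      obtain ⟨t, rfl⟩ := exists_eq_exp_of_norm_eq_one hz
      exact h t
  exact ⟨h.1, ⟨hF.1, h.2⟩, fun hT => not_mem_polysWithZerosIn_unitCircle hn hF hT.1⟩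

theorem imProduct_nonneg_of_mem_closedD {n : ℕ} {lam : ℝ} {F : ℂ[X]} (hF : F ∈ closedD n lam)
    {z : ℂ} (hz : ‖z‖ = 1) : 0 ≤ imProduct n lam F z := by
  have hc : Continuous fun r : ℝ => imProduct n lam F (r * z) :=
    (continuous_imProduct n lam F).comp (by fun_prop)
  have hlim := (hc.tendsto 1).mono_left (nhdsWithin_le_nhds (s := Set.Ioi 1))
  rw [Complex.ofReal_one, one_mul] at hlim
  refine ge_of_tendsto hlim ?_
  filter_upwards [self_mem_nhdsWithin] with r (hr : 1 < r)
  refine ((imQuotient_pos_iff n lam F _).1 (hF.2 _ ?_)).le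
  rw [norm_mul, hz, mul_one, Complex.norm_real, Real.norm_of_nonneg (by linarith)]
  exact hr

theorem mem_closedT_of_wronskian_eq_zero {n : ℕ} {lam : ℝ} (hn : 1 ≤ n) (hlam0 : 0 < lam)
    (hlam1 : lam < 2 * Real.pi / n) {F : ℂ[X]} (hF : F ∈ closedD n lam)
    (hT : plusRot lam F * minusRot lam (nInverse n F)
      - minusRot lam F * plusRot lam (nInverse n F) = 0) : F ∈ closedT n lam := by
  have hroots : ∀ z, F.IsRoot z → ‖z‖ = 1 := fun z hz =>
    norm_eq_one_of_wronskian_eq_zero hn hlam0 hlam1 hF.1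
      (fun z hz => norm_le_one_of_mem_closedD hF hz) hT hz
  exact ⟨⟨hF.1, hroots⟩, fun z w hzw => le_abs_arg_of_mem_closedD hn hlam0 hlam1 hF hroots hzw⟩

theorem mem_openD_of_hasExactlyCriticalPoints {n : ℕ} {lam : ℝ} (hn : 1 ≤ n) (hlam0 : 0 < lam)
    (hlam1 : lam < 2 * Real.pi / n) {F U : ℂ[X]} {κ : ℂ}
    (hU : IsRealOnCircle n κ (fun t => imProduct n lam F (Complex.exp (t * Complex.I))) U)
    (hF : F ∈ polysWithZerosIn n openDisk)
    (hcrit : HasExactlyCriticalPoints U closedDisk (n - 1)) : F ∈ openD n lam \ openT n lam := by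
  have hroot : ∀ z : ℂ, ‖z‖ = 1 → ¬ U.IsRoot z := fun z hz =>
    hU.not_isRoot_of_hasExactlyCriticalPoints hn hcrit hz
  have hU0 : U ≠ 0 := by
    rintro rfl
    exact hcrit.1 derivative_zero
  obtain ⟨h1, h2, -⟩ := mem_closedD_of_circleZerosEven hn hlam0 hlam1 hU hF
    ⟨hU0, fun z hz hr => absurd hr (hroot z hz)⟩
  refine ⟨Or.inr ⟨hF.1, fun z hz => ?_⟩, fun hT => not_mem_polysWithZerosIn_unitCircle hn hF hT.1⟩
  rcases hz.eq_or_lt with heq | hlt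
  · rw [imQuotient_pos_iff]
    refine lt_of_le_of_ne (h1 z heq.symm) fun h0 => hroot z heq.symm ?_
    obtain ⟨t, rfl⟩ := exists_eq_exp_of_norm_eq_one heq.symm
    exact (hU.isRoot_iff t).2 h0.symm
  · exact h2.2 z hlt

theorem hasExactlyCriticalPoints_of_mem_openD {n : ℕ} {lam : ℝ} (hn : 1 ≤ n) {F U : ℂ[X]} {κ : ℂ}
    (hU : IsRealOnCircle n κ (fun t => imProduct n lam F (Complex.exp (t * Complex.I))) U)
    (hF : F ∈ openD n lam \ openT n lam) : HasExactlyCriticalPoints U openDisk (n - 1) := by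
  obtain ⟨-, hpos⟩ := hF.1.resolve_left hF.2
  refine hU.hasExactlyCriticalPoints_of_pos hn fun t => ?_
  exact (imQuotient_pos_iff n lam F _).1 (hpos _ (Complex.norm_exp_ofReal_mul_I t).ge)

theorem mainTheorem7 (n : ℕ) (hn : 1 ≤ n) (lam : ℝ) (hlam0 : 0 < lam)
    (hlam1 : lam < 2 * Real.pi / n)
    (P Q : ℂ[X])
    (hP : P ∈ polysWithZerosIn n unitCircle) (hQ : Q ∈ polysWithZerosIn n unitCircle)
    (cP cQ : ℂ) (hcP : IsSelfInversiveConst n P cP) (hcQ : IsSelfInversiveConst n Q cQ)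
    (hc : cP ≠ cQ)
    (F S T : ℂ[X]) (hF : F = P - Q)
    (hS : S = plusRot lam P * minusRot lam Q - minusRot lam P * plusRot lam Q)
    (hT : T = plusRot lam F * minusRot lam (nInverse n F)
      - minusRot lam F * plusRot lam (nInverse n F)) :
    (F ∈ polysWithZerosIn n openDisk → (CircleZerosEven S ∨ CircleZerosEven T) →
      F ∈ closedD n lam \ closedT n lam) ∧
    (F ∈ closedD n lam \ closedT n lam → CircleZerosEven S ∧ CircleZerosEven T) ∧
    (F ∈ polysWithZerosIn n openDisk →
      (HasExactlyCriticalPoints S closedDisk (n - 1) ∨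
        HasExactlyCriticalPoints T closedDisk (n - 1)) →
      F ∈ openD n lam \ openT n lam) ∧
    (F ∈ openD n lam \ openT n lam →
      HasExactlyCriticalPoints S openDisk (n - 1) ∧
        HasExactlyCriticalPoints T openDisk (n - 1)) := by
  have hdeg : F.natDegree ≤ n := by
    rw [hF]
    exact (natDegree_sub_le_of_le (natDegree_le_of_degree_eq hP.1)
      (natDegree_le_of_degree_eq hQ.1)).trans (max_self n).le
  have hcc : cP ^ 2 - cQ ^ 2 ≠ 0 := sub_ne_zero.2 (sq_ne_sq_of_isSelfInversiveConst hcP hcQ hc)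
  have hTS : T = C (cP ^ 2 - cQ ^ 2) * S := by
    rw [hT, hS, hF]
    exact wronskian_eq_C_mul hcP hcQ lam
  have realT : IsRealOnCircle n (2 * Complex.I)
      (fun t => imProduct n lam F (Complex.exp (t * Complex.I))) T := by
    refine ⟨mul_ne_zero two_ne_zero Complex.I_ne_zero, fun t => ?_⟩
    rw [hT]
    exact eval_wronskian hdeg lam (Complex.norm_exp_ofReal_mul_I t)
  have realS : IsRealOnCircle n (2 * Complex.I / (cP ^ 2 - cQ ^ 2))
      (fun t => imProduct n lam F (Complex.exp (t * Complex.I))) S := by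
    refine ⟨div_ne_zero realT.const_ne_zero hcc, fun t => ?_⟩
    have h := realT.eval_eq t
    rw [hTS, eval_mul, eval_C] at h
    refine mul_left_cancel₀ hcc ?_
    rw [h]
    field_simp
  refine ⟨fun hFD h => ?_, fun hFD => ?_, fun hFD h => ?_, fun hFD => ?_⟩
  · rcases h with h | h
    · exact (mem_closedD_of_circleZerosEven hn hlam0 hlam1 realS hFD h).2
    · exact (mem_closedD_of_circleZerosEven hn hlam0 hlam1 realT hFD h).2
  · have hT0 : T ≠ 0 := fun h0 =>
      hFD.2 (mem_closedT_of_wronskian_eq_zero hn hlam0 hlam1 hFD.1 (hT ▸ h0))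
    have hS0 : S ≠ 0 := by
      rintro h0
      exact hT0 (by rw [hTS, h0, mul_zero])
    have hρ : ∀ t : ℝ, 0 ≤ imProduct n lam F (Complex.exp (t * Complex.I)) := fun t =>
      imProduct_nonneg_of_mem_closedD hFD.1 (Complex.norm_exp_ofReal_mul_I t)
    exact ⟨realS.circleZerosEven_of_nonneg hS0 hρ, realT.circleZerosEven_of_nonneg hT0 hρ⟩
  · rcases h with h | h
    · exact mem_openD_of_hasExactlyCriticalPoints hn hlam0 hlam1 realS hFD h
    · exact mem_openD_of_hasExactlyCriticalPoints hn hlam0 hlam1 realT hFD h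
  · exact ⟨hasExactlyCriticalPoints_of_mem_openD hn realS hFD,
      hasExactlyCriticalPoints_of_mem_openD hn realT hFD⟩
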